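/- Let $\mathsf{var}$ and $\mathsf{par}$ be disjoint finite sets, of (propositional) variables and of parameters; their elements are the atoms. Formulas are built from atoms and $\bot$ by $\wedge,\vee,\to$, with $\top:=\bot\to\bot$, and $\vdash$ denotes derivability in intuitionistic propositional logic. The empty disjunction is $\bot$. Substitutions commute with the connectives and $\bot$ and fix every parameter. The implication depth $c_\to$ is given by $c_\to(a)=c_\to(\top)=c_\to(\bot)=0$ for atoms $a$, $c_\to(A\wedge B)=c_\to(A\vee B)=\max\{c_\to(A),c_\to(B)\}$, and otherwise $c_\to(A\to B)=1+\max\{c_\to(A),c_\to(B)\}$. Let $\mathsf{NI}$ be the set of formulas built from atoms and $\bot$ by $\wedge,\vee$. Let $\mathsf{NNIL}$ be the least set of formulas that contains the atoms and $\bot$, is closed under $\wedge,\vee$, and contains $B\to C$ whenever $B\in\mathsf{NI}$ and $C\in\mathsf{NNIL}$. Let $\mathsf{NNIL}(\mathsf{par})$ be the set of formulas in $\mathsf{NNIL}$ all of whose atoms are parameters. For a set $\Gamma$ of formulas, a formula $B$ is $\Gamma$-projective if there are a substitution $\theta$ and $B'\in\Gamma$ such that $\vdash\theta(B)\leftrightarrow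 B'$ and $B\vdash a\leftrightarrow\theta(a)$ for every atom $a$. A formula $A$ admissibly implies $B$ relative to $\Gamma$ if for every substitution $\theta$ and every $C\in\Gamma$, $\vdash\theta(C\to A)$ implies $\vdash\theta(C\to B)$. A finite set $\Pi$ of formulas is a $\Gamma$-projective resolution of $A$ if 1. for all $B,C\in\Pi$, $\vdash B\to C$ implies $B=C$; 2. every $B\in\Pi$ is $\Gamma$-projective; 3. $A$ admissibly implies $\bigvee\Pi$ relative to $\Gamma$; 4. $\vdash\bigvee\Pi\to A$. **Theorem.** Every formula $A$ has a finite $\mathsf{NNIL}(\mathsf{par})$-projective resolution $\Pi$ such that $c_\to(B)\le\max\{c_\to(A),\,1+\#\mathsf{par}\}$ for every $B\in\Pi$, where $\#\mathsf{par}$ is the number of parameters. Moreover, $\Pi$ can be chosen to be a computable function of $A$. -/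

import Mathlib

namespace RelUnif

/-- Propositional formulas over variables `V` and parameters `P`; the atoms are `V ⊕ P`. -/
inductive Formula (V P : Type) : Type
  | atom : V ⊕ P → Formula V P
  | bot : Formula V P
  | and : Formula V P → Formula V P → Formula V P
  | or : Formula V P → Formula V P → Formula V P
  | imp : Formula V P → Formula V P → Formula V P
  deriving DecidableEq

namespace Formula

variable {V P : Type}

/-- `⊤ := ¬⊥`. -/
def top : Formula V P := imp bot bot

def iff (A B : Formula V P) : Formula V P := and (imp A B) (imp B A)

/-- The set of atoms that occur in a formula. -/
def atoms : Formula V P → Set (V ⊕ P)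
  | atom a => {a}
  | bot => ∅
  | and A B => atoms A ∪ atoms B
  | or A B => atoms A ∪ atoms B
  | imp A B => atoms A ∪ atoms B

/-- The maximal number of nested implications.  The constant `⊤ = ⊥ → ⊥` has depth `0`. -/
def impDepth : Formula V P → ℕ
  | atom _ => 0
  | bot => 0
  | and A B => max (impDepth A) (impDepth B)
  | or A B => max (impDepth A) (impDepth B)
  | imp bot bot => 0
  | imp A B => 1 + max (impDepth A) (impDepth B)

/-- Finite disjunctions; the empty disjunction is `⊥`. -/
def listDisj : List (Formula V P) → Formula V P
  | [] => bot
  | A :: l => or A (listDisj l)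

/-- `⋁ S` for a finite set `S` (in some order, which is irrelevant up to provable equivalence). -/
noncomputable def bigOr (S : Finset (Formula V P)) : Formula V P := listDisj S.toList

end Formula

/-- Natural deduction for intuitionistic propositional logic: `Prov Γ A` means `Γ ⊢ A`. -/
inductive Prov {V P : Type} : Set (Formula V P) → Formula V P → Prop
  | hyp {Γ : Set (Formula V P)} {A : Formula V P} : A ∈ Γ → Prov Γ A
  | botE {Γ : Set (Formula V P)} {A : Formula V P} : Prov Γ Formula.bot → Prov Γ A
  | andI {Γ : Set (Formula V P)} {A B : Formula V P} :
      Prov Γ A → Prov Γ B → Prov Γ (Formula.and A B)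
  | andE₁ {Γ : Set (Formula V P)} {A B : Formula V P} : Prov Γ (Formula.and A B) → Prov Γ A
  | andE₂ {Γ : Set (Formula V P)} {A B : Formula V P} : Prov Γ (Formula.and A B) → Prov Γ B
  | orI₁ {Γ : Set (Formula V P)} {A B : Formula V P} : Prov Γ A → Prov Γ (Formula.or A B)
  | orI₂ {Γ : Set (Formula V P)} {A B : Formula V P} : Prov Γ B → Prov Γ (Formula.or A B)
  | orE {Γ : Set (Formula V P)} {A B C : Formula V P} :
      Prov Γ (Formula.or A B) → Prov (insert A Γ) C → Prov (insert B Γ) C → Prov Γ C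
  | impI {Γ : Set (Formula V P)} {A B : Formula V P} :
      Prov (insert A Γ) B → Prov Γ (Formula.imp A B)
  | impE {Γ : Set (Formula V P)} {A B : Formula V P} :
      Prov Γ (Formula.imp A B) → Prov Γ A → Prov Γ B

/-- `⊢ A` in intuitionistic propositional logic. -/
def Provable {V P : Type} (A : Formula V P) : Prop := Prov ∅ A

/-- A substitution is given by its values on variables; it fixes every parameter. -/
abbrev Subst (V P : Type) : Type := V → Formula V P

/-- The action of a substitution on formulas. -/
def Subst.app {V P : Type} (θ : Subst V P) : Formula V P → Formula V P
  | Formula.atom (Sum.inl x) => θ x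
  | Formula.atom (Sum.inr p) => Formula.atom (Sum.inr p)
  | Formula.bot => Formula.bot
  | Formula.and A B => Formula.and (Subst.app θ A) (Subst.app θ B)
  | Formula.or A B => Formula.or (Subst.app θ A) (Subst.app θ B)
  | Formula.imp A B => Formula.imp (Subst.app θ A) (Subst.app θ B)

/-- Formulas without implications. -/
inductive IsNI {V P : Type} : Formula V P → Prop
  | atom (a : V ⊕ P) : IsNI (Formula.atom a)
  | bot : IsNI Formula.bot
  | and {A B : Formula V P} : IsNI A → IsNI B → IsNI (Formula.and A B)
  | or {A B : Formula V P} : IsNI A → IsNI B → IsNI (Formula.or A B)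

/-- Formulas with No Nested Implications in the Left. -/
inductive IsNNIL {V P : Type} : Formula V P → Prop
  | atom (a : V ⊕ P) : IsNNIL (Formula.atom a)
  | bot : IsNNIL Formula.bot
  | and {A B : Formula V P} : IsNNIL A → IsNNIL B → IsNNIL (Formula.and A B)
  | or {A B : Formula V P} : IsNNIL A → IsNNIL B → IsNNIL (Formula.or A B)
  | imp {A B : Formula V P} : IsNI A → IsNNIL B → IsNNIL (Formula.imp A B)

/-- `NNIL(par)`: the NNIL formulas all of whose atoms are parameters. -/
def NNILpar (V P : Type) : Set (Formula V P) :=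
  {A | IsNNIL A ∧ A.atoms ⊆ Set.range Sum.inr}

/-- `θ` is `A`-projective: `A ⊢ a ↔ θ(a)` for every atom `a`. -/
def IsProjectiveSubst {V P : Type} (A : Formula V P) (θ : Subst V P) : Prop :=
  ∀ a : V ⊕ P, Prov {A} (Formula.iff (Formula.atom a) (θ.app (Formula.atom a)))

/-- `θ` is a `Γ`-fier for `A`: `θ(A)` is provably equivalent to a member of `Γ`. -/
def IsFier {V P : Type} (Γ : Set (Formula V P)) (A : Formula V P) (θ : Subst V P) : Prop :=
  ∃ A' ∈ Γ, Provable (Formula.iff (θ.app A) A')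

/-- `A` is `Γ`-projective. -/
def IsProjective {V P : Type} (Γ : Set (Formula V P)) (A : Formula V P) : Prop :=
  ∃ θ : Subst V P, IsProjectiveSubst A θ ∧ IsFier Γ A θ

/-- `A` admissibly implies `B` relative to `Γ`. -/
def Admissible {V P : Type} (Γ : Set (Formula V P)) (A B : Formula V P) : Prop :=
  ∀ (θ : Subst V P), ∀ C ∈ Γ, Provable (θ.app (Formula.imp C A)) → Provable (θ.app (Formula.imp C B))

/-- The finite set `S` is a `Γ`-projective resolution of `A`. -/
structure IsProjectiveResolution {V P : Type} (Γ : Set (Formula V P))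
    (S : Finset (Formula V P)) (A : Formula V P) : Prop where
  independent : ∀ B ∈ S, ∀ C ∈ S, Provable (Formula.imp B C) → B = C
  projective : ∀ B ∈ S, IsProjective Γ B
  admissible : Admissible Γ A (Formula.bigOr S)
  implies : Provable (Formula.imp (Formula.bigOr S) A)

/-! Gödel numbering of the formulas in `m` variables and `k` parameters, as a bijection with `ℕ`;
it makes Mathlib's `Computable` available for functions on formulas. -/

/-- The Gödel number of a formula. -/
def toCode {m k : ℕ} : Formula (Fin m) (Fin k) → ℕ
  | Formula.atom (Sum.inl i) => i
  | Formula.atom (Sum.inr j) => m + j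
  | Formula.bot => m + k
  | Formula.and A B => 3 * Nat.pair (toCode A) (toCode B) + (m + k + 1)
  | Formula.or A B => 3 * Nat.pair (toCode A) (toCode B) + 1 + (m + k + 1)
  | Formula.imp A B => 3 * Nat.pair (toCode A) (toCode B) + 2 + (m + k + 1)

/-- The formula with a given Gödel number. -/
def ofCode (m k : ℕ) (n : ℕ) : Formula (Fin m) (Fin k) :=
  if h₁ : n < m then Formula.atom (Sum.inl ⟨n, h₁⟩)
  else if h₂ : n < m + k then Formula.atom (Sum.inr ⟨n - m, by omega⟩)
  else if h₃ : n = m + k then Formula.bot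
  else
    have hl : (Nat.unpair ((n - (m + k + 1)) / 3)).1 < n :=
      lt_of_le_of_lt (Nat.unpair_left_le _) (by omega)
    have hr : (Nat.unpair ((n - (m + k + 1)) / 3)).2 < n :=
      lt_of_le_of_lt (Nat.unpair_right_le _) (by omega)
    let A := ofCode m k (Nat.unpair ((n - (m + k + 1)) / 3)).1
    let B := ofCode m k (Nat.unpair ((n - (m + k + 1)) / 3)).2
    if (n - (m + k + 1)) % 3 = 0 then Formula.and A B
    else if (n - (m + k + 1)) % 3 = 1 then Formula.or A B
    else Formula.imp A B
termination_by n

theorem ofCode_toCode {m k : ℕ} (A : Formula (Fin m) (Fin k)) : ofCode m k (toCode A) = A := by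
  induction A with
  | atom a =>
    rcases a with i | j
    · rw [toCode, ofCode, dif_pos i.isLt]
    · have h₁ : ¬ m + (j : ℕ) < m := by omega
      have h₂ : m + (j : ℕ) < m + k := by omega
      rw [toCode, ofCode, dif_neg h₁, dif_pos h₂]
      simp
  | bot => rw [toCode, ofCode]; simp
  | and A B ihA ihB =>
    rw [toCode, ofCode, dif_neg (by omega), dif_neg (by omega), dif_neg (by omega)]
    simp [ihA, ihB]
  | or A B ihA ihB =>
    have hd : (3 * Nat.pair (toCode A) (toCode B) + 1) / 3
        = Nat.pair (toCode A) (toCode B) := by omega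
    rw [toCode, ofCode, dif_neg (by omega), dif_neg (by omega), dif_neg (by omega)]
    simp [hd, ihA, ihB]
  | imp A B ihA ihB =>
    have hd : (3 * Nat.pair (toCode A) (toCode B) + 2) / 3
        = Nat.pair (toCode A) (toCode B) := by omega
    rw [toCode, ofCode, dif_neg (by omega), dif_neg (by omega), dif_neg (by omega)]
    simp [hd, ihA, ihB]

theorem toCode_ofCode (m k : ℕ) (n : ℕ) : toCode (ofCode m k n) = n := by
  induction n using Nat.strong_induction_on with
  | _ n ih =>
    rw [ofCode]
    split_ifs with h₁ h₂ h₃ h₄ h₅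
    · simp only [toCode]
    · simp only [toCode]; omega
    · simp only [toCode]; omega
    all_goals
      simp only [toCode]
      rw [ih _ (lt_of_le_of_lt (Nat.unpair_left_le _) (by omega)),
        ih _ (lt_of_le_of_lt (Nat.unpair_right_le _) (by omega)), Nat.pair_unpair]
      omega

instance instDenumerableFormula (m k : ℕ) : Denumerable (Formula (Fin m) (Fin k)) :=
  Denumerable.mk' ⟨toCode, ofCode m k, ofCode_toCode, toCode_ofCode m k⟩

end RelUnif

/-!
The argument is Ghilardi's analysis of projective formulas, adapted to parameters and carried out
in the canonical Kripke model: a point is a prime theory, a substitution `σ` acts on points by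
preimages, and a new root below the points extending a theory `T` is described by the Aczel slash
`Slash Z T`.

A formula `B` has the *extension property* relative to a formula `C` in the parameters
(`HasExtension`) if every new root that satisfies `C` and lies below points satisfying `B` only
can be given values of the variables that make `B` true. Two facts carry the proof.

* If `B` has the extension property relative to `C` and `⊢ B → C`, then `B` is projective, and its
  projective substitution turns `B` into a formula equivalent to `C`
  (`HasExtension.isProjective`). To each point containing `C` and refuting `σ(B)`, for a
  `B`-projective substitution `σ`, one attaches its data: its parameters and the implications
  `σ(B) → σ(D)` true there, with `D` a subformula of `B` or `C`. All points whose data is a given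
  maximal one look like a single root below the points satisfying `σ(B)`, and the extension
  property tells how to modify `σ` so that this data disappears and no new data appears except
  below old ones (`exists_failureData_ssubset`). As there are finitely many possible data,
  repetition leaves no refuting point.
* If `C ⊢ θ(A)`, where `A` has depth at most `n + 1` and `C` depth at most `n`, then the
  conjunction `B` of all formulas `D` of depth at most `n + 1` with `C ⊢ θ(D)`, finitely many up to
  equivalence, has the extension property relative to `C` (`exists_hasExtension`).

An `NNIL` formula in `k` parameters is equivalent to one of depth at most `k`, because an
implication `p → E` is only needed when `p` is not yet assumed (`isReducible_of_mem_NNILpar`).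
Hence, with `N = max (depth of A) (1 + k)`, the maximal ones among the representatives of depth at
most `N` that imply `A` and have the extension property relative to some `NNIL` formula they imply
form a projective resolution.

For computability, provability is decided by the finite model property (`provable_iff_truth`), and
the extension property only depends on which subformulas of `B` and `C` belong to the theory, so
that it becomes a bounded search with provability tests (`hasFiniteExtension_iff`).
-/

namespace RelUnif

open Formula hiding and or

variable {V P : Type}

/-! ### Derivations -/

theorem Prov.mono {Γ Δ : Set (Formula V P)} {A : Formula V P} (h : Prov Γ A) (hs : Γ ⊆ Δ) :
    Prov Δ A := by
  induction h generalizing Δ with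
  | hyp h => exact .hyp (hs h)
  | botE _ ih => exact .botE (ih hs)
  | andI _ _ ih₁ ih₂ => exact .andI (ih₁ hs) (ih₂ hs)
  | andE₁ _ ih => exact .andE₁ (ih hs)
  | andE₂ _ ih => exact .andE₂ (ih hs)
  | orI₁ _ ih => exact .orI₁ (ih hs)
  | orI₂ _ ih => exact .orI₂ (ih hs)
  | orE _ _ _ ih ih₁ ih₂ =>
    exact .orE (ih hs) (ih₁ (Set.insert_subset_insert hs)) (ih₂ (Set.insert_subset_insert hs))
  | impI _ ih => exact .impI (ih (Set.insert_subset_insert hs))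
  | impE _ _ ih₁ ih₂ => exact .impE (ih₁ hs) (ih₂ hs)

theorem Prov.cut {Γ : Set (Formula V P)} {A B : Formula V P} (h : Prov Γ A)
    (h' : Prov (insert A Γ) B) : Prov Γ B :=
  .impE (.impI h') h

theorem prov_imp_iff {Γ : Set (Formula V P)} {A B : Formula V P} :
    Prov Γ (imp A B) ↔ Prov (insert A Γ) B :=
  ⟨fun h => .impE (h.mono (Set.subset_insert _ _)) (.hyp (Set.mem_insert _ _)), .impI⟩

/-- A derivation uses only finitely many hypotheses. -/
theorem Prov.exists_finite {Γ : Set (Formula V P)} {A : Formula V P} (h : Prov Γ A) :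
    ∃ Δ ⊆ Γ, Δ.Finite ∧ Prov Δ A := by
  have key : ∀ {Γ Δ : Set (Formula V P)} {A' : Formula V P}, Δ ⊆ insert A' Γ →
      Δ \ {A'} ⊆ Γ ∧ Δ ⊆ insert A' (Δ \ {A'}) := fun {_ _ A'} h =>
    ⟨fun x hx => (h hx.1).resolve_left hx.2, fun x hx => by
      by_cases hxA : x = A'
      · exact Or.inl hxA
      · exact Or.inr ⟨hx, hxA⟩⟩
  induction h with
  | @hyp Γ A h => exact ⟨{A}, by simpa using h, Set.finite_singleton _, .hyp rfl⟩
  | botE _ ih => obtain ⟨Δ, h, hf, hp⟩ := ih; exact ⟨Δ, h, hf, .botE hp⟩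
  | andI _ _ ih₁ ih₂ =>
    obtain ⟨Δ, h, hf, hp⟩ := ih₁
    obtain ⟨Δ', h', hf', hp'⟩ := ih₂
    exact ⟨Δ ∪ Δ', Set.union_subset h h', hf.union hf',
      .andI (hp.mono Set.subset_union_left) (hp'.mono Set.subset_union_right)⟩
  | andE₁ _ ih => obtain ⟨Δ, h, hf, hp⟩ := ih; exact ⟨Δ, h, hf, .andE₁ hp⟩
  | andE₂ _ ih => obtain ⟨Δ, h, hf, hp⟩ := ih; exact ⟨Δ, h, hf, .andE₂ hp⟩
  | orI₁ _ ih => obtain ⟨Δ, h, hf, hp⟩ := ih; exact ⟨Δ, h, hf, .orI₁ hp⟩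
  | orI₂ _ ih => obtain ⟨Δ, h, hf, hp⟩ := ih; exact ⟨Δ, h, hf, .orI₂ hp⟩
  | @orE Γ A B C _ _ _ ih ih₁ ih₂ =>
    obtain ⟨Δ, h, hf, hp⟩ := ih
    obtain ⟨Δ₁, h₁, hf₁, hp₁⟩ := ih₁
    obtain ⟨Δ₂, h₂, hf₂, hp₂⟩ := ih₂
    refine ⟨Δ ∪ (Δ₁ \ {A} ∪ Δ₂ \ {B}),
      Set.union_subset h (Set.union_subset (key h₁).1 (key h₂).1),
      hf.union (hf₁.sdiff.union hf₂.sdiff), .orE (A := A) (B := B) (hp.mono ?_) (hp₁.mono ?_)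
        (hp₂.mono ?_)⟩
    · exact Set.subset_union_left
    · exact (key h₁).2.trans (Set.insert_subset_insert
        (Set.subset_union_left.trans Set.subset_union_right))
    · exact (key h₂).2.trans (Set.insert_subset_insert
        (Set.subset_union_right.trans Set.subset_union_right))
  | @impI Γ A B _ ih =>
    obtain ⟨Δ, h, hf, hp⟩ := ih
    exact ⟨Δ \ {A}, (key h).1, hf.sdiff, .impI (hp.mono (key h).2)⟩
  | impE _ _ ih₁ ih₂ =>
    obtain ⟨Δ, h, hf, hp⟩ := ih₁
    obtain ⟨Δ', h', hf', hp'⟩ := ih₂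
    exact ⟨Δ ∪ Δ', Set.union_subset h h', hf.union hf',
      .impE (hp.mono Set.subset_union_left) (hp'.mono Set.subset_union_right)⟩

theorem Prov.subst (σ : Subst V P) {Γ : Set (Formula V P)} {A : Formula V P} (h : Prov Γ A) :
    Prov (σ.app '' Γ) (σ.app A) := by
  induction h with
  | hyp h => exact .hyp (Set.mem_image_of_mem _ h)
  | botE _ ih => exact .botE ih
  | andI _ _ ih₁ ih₂ => exact .andI ih₁ ih₂
  | andE₁ _ ih => exact .andE₁ ih
  | andE₂ _ ih => exact .andE₂ ih
  | orI₁ _ ih => exact .orI₁ ih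
  | orI₂ _ ih => exact .orI₂ ih
  | orE _ _ _ ih ih₁ ih₂ =>
    rw [Set.image_insert_eq] at ih₁ ih₂
    exact .orE ih ih₁ ih₂
  | impI _ ih => rw [Set.image_insert_eq] at ih; exact .impI ih
  | impE _ _ ih₁ ih₂ => exact .impE ih₁ ih₂

theorem Subst.app_eq_self (σ : Subst V P) {A : Formula V P} (h : A.atoms ⊆ Set.range Sum.inr) :
    σ.app A = A := by
  induction A with
  | atom a => obtain ⟨p, rfl⟩ := h (Set.mem_singleton a); rfl
  | bot => rfl
  | and A B ihA ihB | or A B ihA ihB | imp A B ihA ihB =>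
    simp only [Subst.app, ihA (Set.subset_union_left.trans h), ihB (Set.subset_union_right.trans h)]

/-- Finite conjunctions; the empty conjunction is `⊤`. -/
def listConj : List (Formula V P) → Formula V P
  | [] => top
  | A :: l => Formula.and A (listConj l)

/-! ### Theories and prime theories -/

/-- A theory is a deductively closed set of formulas. -/
def IsTheory (T : Set (Formula V P)) : Prop := ∀ A, Prov T A → A ∈ T

/-- A prime theory is a consistent theory with the disjunction property; the prime theories,
ordered by inclusion, are the points of the canonical Kripke model. -/
structure IsPrime (u : Set (Formula V P)) : Prop where
  theory : IsTheory u
  bot : bot ∉ u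
  or : ∀ A B, Formula.or A B ∈ u → A ∈ u ∨ B ∈ u

theorem isTheory_setOf_prov (Γ : Set (Formula V P)) : IsTheory {A | Prov Γ A} := by
  intro A h
  obtain ⟨Δ, hΔ, hf, hp⟩ := h.exists_finite
  clear h
  induction Δ, hf using Set.Finite.induction_on generalizing A with
  | empty => exact hp.mono (Set.empty_subset _)
  | @insert B Δ _ _ ih =>
    have h1 := ih ((Set.subset_insert _ _).trans hΔ) (A := imp B A) (.impI hp)
    exact .impE h1 (hΔ (Set.mem_insert _ _))

/-- A set of formulas that does not derive `A` is contained in a prime theory without `A`. -/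
theorem exists_isPrime {Γ : Set (Formula V P)} {A : Formula V P} (h : ¬ Prov Γ A) :
    ∃ u, IsPrime u ∧ Γ ⊆ u ∧ A ∉ u := by
  obtain ⟨u, hΓu, hu⟩ := zorn_subset_nonempty {Δ : Set (Formula V P) | ¬ Prov Δ A} (by
    intro c hc hchain hne
    refine ⟨⋃₀ c, fun hp => ?_, fun s hs => Set.subset_sUnion_of_mem hs⟩
    obtain ⟨Δ, hΔ, hf, hp⟩ := hp.exists_finite
    obtain ⟨s, hs, hΔs⟩ := DirectedOn.exists_mem_subset_of_finite_of_subset_sUnion hne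
      hchain.directedOn hf hΔ
    exact hc hs (hp.mono hΔs)) Γ h
  have hnp : ¬ Prov u A := hu.prop
  have hmax : ∀ B, ¬ Prov (insert B u) A → B ∈ u := fun B hB =>
    hu.le_of_ge (y := insert B u) hB (Set.subset_insert _ _) (Set.mem_insert _ _)
  have hthy : IsTheory u := fun B hB => hmax B fun hp => hnp (hB.cut hp)
  refine ⟨u, ⟨hthy, fun hb => hnp (.botE (.hyp hb)), fun B C hBC => ?_⟩, hΓu,
    fun hA => hnp (.hyp hA)⟩
  by_contra! hcon
  have h1 : Prov (insert B u) A := by by_contra h; exact hcon.1 (hmax _ h)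
  have h2 : Prov (insert C u) A := by by_contra h; exact hcon.2 (hmax _ h)
  exact hnp (.orE (.hyp hBC) h1 h2)

/-- Soundness and completeness for prime theories. -/
theorem prov_iff_forall_isPrime {Γ : Set (Formula V P)} {A : Formula V P} :
    Prov Γ A ↔ ∀ u, IsPrime u → Γ ⊆ u → A ∈ u := by
  refine ⟨fun h u hu hΓ => hu.theory _ (h.mono hΓ), fun h => ?_⟩
  by_contra hn
  obtain ⟨u, hu, hΓ, hA⟩ := exists_isPrime hn
  exact hA (h u hu hΓ)

theorem IsTheory.mem_iff {T : Set (Formula V P)} (hT : IsTheory T) {A : Formula V P} :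
    A ∈ T ↔ ∀ u, IsPrime u → T ⊆ u → A ∈ u :=
  ⟨fun h _ _ hu => hu h, fun h => hT _ (prov_iff_forall_isPrime.2 h)⟩

theorem IsTheory.imp_mem_iff {T : Set (Formula V P)} (hT : IsTheory T) {A B : Formula V P} :
    imp A B ∈ T ↔ ∀ u, IsPrime u → T ⊆ u → A ∈ u → B ∈ u := by
  have : imp A B ∈ T ↔ Prov (insert A T) B :=
    ⟨fun h => prov_imp_iff.1 (.hyp h), fun h => hT _ (.impI h)⟩
  rw [this, prov_iff_forall_isPrime]
  simp only [Set.insert_subset_iff]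
  exact ⟨fun h u hu hs hA => h u hu ⟨hA, hs⟩, fun h u hu hs => h u hu hs.2 hs.1⟩

theorem IsTheory.mp {T : Set (Formula V P)} (hT : IsTheory T) {A B : Formula V P}
    (h : imp A B ∈ T) (hA : A ∈ T) : B ∈ T :=
  hT _ (.impE (.hyp h) (.hyp hA))

theorem IsTheory.and_mem_iff {T : Set (Formula V P)} (hT : IsTheory T) {A B : Formula V P} :
    Formula.and A B ∈ T ↔ A ∈ T ∧ B ∈ T :=
  ⟨fun h => ⟨hT _ (.andE₁ (.hyp h)), hT _ (.andE₂ (.hyp h))⟩,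
    fun h => hT _ (.andI (.hyp h.1) (.hyp h.2))⟩

theorem IsTheory.top_mem {T : Set (Formula V P)} (hT : IsTheory T) : top ∈ T :=
  hT _ (.impI (.hyp (Set.mem_insert _ _)))

theorem IsTheory.listConj_mem_iff {T : Set (Formula V P)} (hT : IsTheory T)
    {l : List (Formula V P)} : listConj l ∈ T ↔ ∀ A ∈ l, A ∈ T := by
  induction l with
  | nil => simpa [listConj] using hT.top_mem
  | cons A l ih => simp [listConj, hT.and_mem_iff, ih]

namespace IsPrime

variable {u : Set (Formula V P)}

theorem or_mem_iff (hu : IsPrime u) {A B : Formula V P} : Formula.or A B ∈ u ↔ A ∈ u ∨ B ∈ u :=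
  ⟨hu.or A B, fun h => hu.theory _ (h.elim (fun h => .orI₁ (.hyp h)) fun h => .orI₂ (.hyp h))⟩

theorem listDisj_mem_iff (hu : IsPrime u) {l : List (Formula V P)} :
    listDisj l ∈ u ↔ ∃ A ∈ l, A ∈ u := by
  induction l with
  | nil => simpa [listDisj] using hu.bot
  | cons A l ih => simp [listDisj, hu.or_mem_iff, ih]

theorem bigOr_mem_iff (hu : IsPrime u) {S : Finset (Formula V P)} :
    bigOr S ∈ u ↔ ∃ A ∈ S, A ∈ u := by
  simp [bigOr, hu.listDisj_mem_iff]

end IsPrime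

theorem prov_singleton_iff {A B : Formula V P} :
    Prov {A} B ↔ ∀ u, IsPrime u → A ∈ u → B ∈ u := by
  simp [prov_iff_forall_isPrime]

theorem provable_imp_iff {A B : Formula V P} :
    Provable (imp A B) ↔ ∀ u, IsPrime u → A ∈ u → B ∈ u := by
  rw [Provable, prov_imp_iff, insert_empty_eq, prov_singleton_iff]

theorem IsTheory.iff_mem_iff {T : Set (Formula V P)} (hT : IsTheory T) {A B : Formula V P} :
    Formula.iff A B ∈ T ↔ imp A B ∈ T ∧ imp B A ∈ T :=
  hT.and_mem_iff

theorem Provable.subst (σ : Subst V P) {A : Formula V P} (h : Provable A) : Provable (σ.app A) := by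
  simpa [Provable] using Prov.subst σ h

/-- The preimage of a prime theory under a substitution is a prime theory. -/
theorem IsPrime.comap {u : Set (Formula V P)} (hu : IsPrime u) (σ : Subst V P) :
    IsPrime (σ.app ⁻¹' u) where
  theory _ h := hu.theory _ ((Prov.subst σ h).mono (Set.image_preimage_subset _ _))
  bot h := hu.bot h
  or _ _ h := hu.or _ _ h

/-! ### The slash relation -/

/-- The Aczel slash: `Slash Z T` is the set of formulas true at a new root, with valuation bounded
by `Z`, placed below the points of the canonical model that contain the theory `T`.  An atom that
fails somewhere above is false at the root, whatever `Z` says. -/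
def Slash (Z : V ⊕ P → Prop) (T : Set (Formula V P)) : Formula V P → Prop
  | atom a => Z a ∧ atom a ∈ T
  | bot => False
  | Formula.and A B => Slash Z T A ∧ Slash Z T B
  | Formula.or A B => Slash Z T A ∨ Slash Z T B
  | imp A B => (Slash Z T A → Slash Z T B) ∧ imp A B ∈ T

theorem Slash.mem {Z : V ⊕ P → Prop} {T : Set (Formula V P)} (hT : IsTheory T)
    {A : Formula V P} (h : Slash Z T A) : A ∈ T := by
  induction A with
  | atom a => exact h.2
  | bot => exact h.elim
  | and A B ihA ihB => exact hT.and_mem_iff.2 ⟨ihA h.1, ihB h.2⟩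
  | or A B ihA ihB =>
    exact hT _ (h.elim (fun h => .orI₁ (.hyp (ihA h))) fun h => .orI₂ (.hyp (ihB h)))
  | imp A B ihA ihB => exact h.2

theorem Slash.of_prov {Z : V ⊕ P → Prop} {T : Set (Formula V P)} (hT : IsTheory T)
    {Γ : Set (Formula V P)} {A : Formula V P} (h : Prov Γ A) (hΓ : ∀ B ∈ Γ, Slash Z T B) :
    Slash Z T A := by
  induction h with
  | hyp h => exact hΓ _ h
  | botE _ ih => exact (ih hΓ).elim
  | andI _ _ ih₁ ih₂ => exact ⟨ih₁ hΓ, ih₂ hΓ⟩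
  | andE₁ _ ih => exact (ih hΓ).1
  | andE₂ _ ih => exact (ih hΓ).2
  | orI₁ _ ih => exact Or.inl (ih hΓ)
  | orI₂ _ ih => exact Or.inr (ih hΓ)
  | orE _ _ _ ih ih₁ ih₂ =>
    rcases ih hΓ with h | h
    · exact ih₁ (by simpa using ⟨h, hΓ⟩)
    · exact ih₂ (by simpa using ⟨h, hΓ⟩)
  | impI h ih =>
    exact ⟨fun hA => ih (by simpa using ⟨hA, hΓ⟩),
      hT _ ((Prov.impI h).mono fun B hB => (hΓ B hB).mem hT)⟩
  | impE _ _ ih₁ ih₂ => exact (ih₁ hΓ).1 (ih₂ hΓ)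

/-- `B` has the extension property relative to `C`: whenever a new root satisfying `C` is placed
below a theory containing `B`, the variables can be valued at the root so that `B` holds there.
The valuation `Y` of the parameters is prescribed. -/
def HasExtension (B C : Formula V P) : Prop :=
  ∀ T : Set (Formula V P), IsTheory T → B ∈ T → ∀ Y : P → Prop,
    Slash (Sum.elim (fun _ => False) Y) T C → ∃ X : V → Prop, Slash (Sum.elim X Y) T B

/-! ### Subformulas -/

/-- The list of subformulas of a formula. -/
def subf : Formula V P → List (Formula V P)
  | atom a => [atom a]
  | bot => [bot]
  | Formula.and A B => Formula.and A B :: (subf A ++ subf B)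
  | Formula.or A B => Formula.or A B :: (subf A ++ subf B)
  | imp A B => imp A B :: (subf A ++ subf B)

theorem self_mem_subf (A : Formula V P) : A ∈ subf A := by cases A <;> simp [subf]

/-- Whether a formula is slashed depends only on the members of `T` among its subformulas. -/
theorem slash_congr {Z Z' : V ⊕ P → Prop} {T T' : Set (Formula V P)} {A : Formula V P}
    (hZ : ∀ a ∈ A.atoms, Z a ↔ Z' a) (hT : ∀ B ∈ subf A, B ∈ T ↔ B ∈ T') :
    Slash Z T A ↔ Slash Z' T' A := by
  induction A with
  | atom a => simp [Slash, hZ a rfl, hT _ (self_mem_subf _)]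
  | bot => rfl
  | and A B ihA ihB | or A B ihA ihB | imp A B ihA ihB =>
    have h1 := ihA (fun a ha => hZ a (Or.inl ha)) fun C hC => hT C (by simp [subf, hC])
    have h2 := ihB (fun a ha => hZ a (Or.inr ha)) fun C hC => hT C (by simp [subf, hC])
    simp [Slash, h1, h2, hT _ (self_mem_subf _)]

/-! ### The extension property implies projectivity -/

/-- Suppose that the points `v ⊇ u` refuting `σ(B)` agree on the atoms of `D` under `σ'` and see the
same theory `T` at the points satisfying `σ(B)`, where `σ` and `σ'` agree.  Then all of them can be
identified with the single root described by `Slash Z T`. -/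
theorem app_mem_iff_slash {σ σ' : Subst V P} {B : Formula V P} {u T : Set (Formula V P)}
    {Z : V ⊕ P → Prop} {D : Formula V P}
    (hT : ∀ E ∈ subf D, ∀ v, IsPrime v → u ⊆ v → σ.app B ∉ v →
      (imp (σ.app B) (σ.app E) ∈ v ↔ E ∈ T))
    (hσ : ∀ v, IsPrime v → σ.app B ∈ v → ∀ E, σ'.app E ∈ v ↔ σ.app E ∈ v)
    (hZ : ∀ a ∈ D.atoms, ∀ v, IsPrime v → u ⊆ v → σ.app B ∉ v →
      (σ'.app (atom a) ∈ v ↔ Z a ∧ atom a ∈ T)) :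
    ∀ v, IsPrime v → u ⊆ v → σ.app B ∉ v → (σ'.app D ∈ v ↔ Slash Z T D) := by
  induction D with
  | atom a => exact hZ a rfl
  | bot => exact fun v hv _ _ => iff_false_intro hv.bot
  | and D E ihD ihE | or D E ihD ihE =>
    have hD := ihD (fun F hF => hT F (by simp [subf, hF])) fun a ha => hZ a (Or.inl ha)
    have hE := ihE (fun F hF => hT F (by simp [subf, hF])) fun a ha => hZ a (Or.inr ha)
    intro v hv huv hBv
    simp only [Subst.app, Slash, hv.theory.and_mem_iff, hv.or_mem_iff, hD v hv huv hBv,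
      hE v hv huv hBv]
  | imp D E ihD ihE =>
    have hD := ihD (fun F hF => hT F (by simp [subf, hF])) fun a ha => hZ a (Or.inl ha)
    have hE := ihE (fun F hF => hT F (by simp [subf, hF])) fun a ha => hZ a (Or.inr ha)
    intro v hv huv hBv
    have hT' := hT _ (self_mem_subf _) v hv huv hBv
    constructor
    · intro h
      refine ⟨fun hsD => (hE v hv huv hBv).1 (hv.theory.mp h ((hD v hv huv hBv).2 hsD)), ?_⟩
      refine hT'.1 (hv.theory.imp_mem_iff.2 fun w hw hvw hBw => ?_)
      exact (hσ w hw hBw _).1 (hvw h)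
    · intro h
      refine hv.theory.imp_mem_iff.2 fun w hw hvw hDw => ?_
      by_cases hBw : σ.app B ∈ w
      · refine hw.theory.mp ((hσ w hw hBw (imp D E)).2 ?_) hDw
        exact hw.theory.mp (hvw (hT'.2 h.2)) hBw
      · exact (hE w hw (huv.trans hvw) hBw).2 (h.1 ((hD w hw (huv.trans hvw) hBw).1 hDw))

theorem app_mem_iff_of_forall_atom {σ σ' : Subst V P} {B : Formula V P}
    (h : ∀ v, IsPrime v → σ.app B ∈ v → ∀ x, σ' x ∈ v ↔ σ x ∈ v)
    (D : Formula V P) : ∀ v, IsPrime v → σ.app B ∈ v → (σ'.app D ∈ v ↔ σ.app D ∈ v) := by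
  induction D with
  | atom a => rcases a with x | p; exacts [fun v hv hB => h v hv hB x, fun _ _ _ => Iff.rfl]
  | bot => exact fun _ _ _ => Iff.rfl
  | and D E ihD ihE | or D E ihD ihE =>
    intro v hv hB
    simp only [Subst.app, hv.theory.and_mem_iff, hv.or_mem_iff, ihD v hv hB, ihE v hv hB]
  | imp D E ihD ihE =>
    intro v hv hB
    simp only [Subst.app, hv.theory.imp_mem_iff]
    exact forall_congr' fun w => forall_congr' fun hw => forall_congr' fun hvw => by
      rw [ihD w hw (hvw hB), ihE w hw (hvw hB)]

theorem IsProjectiveSubst.app_mem_iff {B : Formula V P} {σ : Subst V P}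
    (h : IsProjectiveSubst B σ) (D : Formula V P) {v : Set (Formula V P)} (hv : IsPrime v)
    (hB : B ∈ v) : σ.app D ∈ v ↔ D ∈ v := by
  have key := app_mem_iff_of_forall_atom (σ := fun x => atom (Sum.inl x)) (σ' := σ) (B := B)
  have hid : ∀ D : Formula V P, Subst.app (fun x => atom (Sum.inl x)) D = D := by
    intro D
    induction D with
    | atom a => rcases a with x | p <;> rfl
    | bot => rfl
    | and D E ihD ihE | or D E ihD ihE | imp D E ihD ihE => simp only [Subst.app, ihD, ihE]
  simp only [hid] at key
  refine key (fun w hw hBw x => ?_) D v hv hB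
  have hx := hw.theory.iff_mem_iff.1 (prov_singleton_iff.1 (h (Sum.inl x)) w hw hBw)
  exact ⟨fun hm => hw.theory.mp hx.2 hm, fun hm => hw.theory.mp hx.1 hm⟩

theorem isProjectiveSubst_of_forall {B : Formula V P} {σ : Subst V P}
    (h : ∀ x v, IsPrime v → B ∈ v → (σ x ∈ v ↔ atom (Sum.inl x) ∈ v)) :
    IsProjectiveSubst B σ := by
  rintro (x | p)
  · refine prov_singleton_iff.2 fun u hu hB => hu.theory.iff_mem_iff.2 ⟨?_, ?_⟩
    · exact hu.theory.imp_mem_iff.2 fun v hv huv hx => (h x v hv (huv hB)).2 hx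
    · exact hu.theory.imp_mem_iff.2 fun v hv huv hx => (h x v hv (huv hB)).1 hx
  · exact .andI (.impI (.hyp (Set.mem_insert _ _))) (.impI (.hyp (Set.mem_insert _ _)))

open Classical in
/-- Ghilardi's modification of `σ`: at the points refuting `σ(B)`, the variables in `X` become as
true, and the others as false, as possible; nothing changes at the points satisfying `σ(B)`. -/
noncomputable def Subst.modify (σ : Subst V P) (B : Formula V P) (X : V → Prop) : Subst V P :=
  fun x => if X x then imp (σ.app B) (σ x) else Formula.and (σ.app B) (σ x)

theorem Subst.modify_mem_iff (σ : Subst V P) (B : Formula V P) (X : V → Prop) (D : Formula V P)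
    {v : Set (Formula V P)} (hv : IsPrime v) (hB : σ.app B ∈ v) :
    (σ.modify B X).app D ∈ v ↔ σ.app D ∈ v := by
  refine app_mem_iff_of_forall_atom (fun w hw hBw x => ?_) D v hv hB
  rw [Subst.modify]
  split_ifs
  · exact ⟨fun h => hw.theory.mp h hBw,
      fun h => hw.theory.imp_mem_iff.2 fun _ _ hs _ => hs h⟩
  · simp [hw.theory.and_mem_iff, hBw]

/-- The implications `σ(B) → σ(D)` and the parameters that hold at a point `u`, where `D` ranges
over the subformulas of `B` and `C`. -/
def pointData (B C : Formula V P) (σ : Subst V P) (u : Set (Formula V P)) :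
    Set (Formula V P) × Set P :=
  ({D | D ∈ subf B ++ subf C ∧ imp (σ.app B) (σ.app D) ∈ u}, {p | atom (Sum.inr p) ∈ u})

theorem pointData_mono (B C : Formula V P) (σ : Subst V P) {u v : Set (Formula V P)} (h : u ⊆ v) :
    pointData B C σ u ≤ pointData B C σ v :=
  ⟨fun _ hD => ⟨hD.1, h hD.2⟩, fun _ hp => h hp⟩

/-- The data, or less, of the points that contain `C` and refute `σ(B)`. -/
def failureData (B C : Formula V P) (σ : Subst V P) : Set (Set (Formula V P) × Set P) :=
  {d | ∃ u, IsPrime u ∧ C ∈ u ∧ σ.app B ∉ u ∧ d ≤ pointData B C σ u}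

theorem finite_failureData [Finite P] (B C : Formula V P) (σ : Subst V P) :
    (failureData B C σ).Finite := by
  have hf : {D | D ∈ subf B ++ subf C}.Finite := List.finite_toSet _
  refine (hf.finite_subsets.prod (Set.finite_univ (α := Set P))).subset ?_
  rintro d ⟨u, -, -, -, hd⟩
  exact ⟨fun D hD => (hd.1 hD).1, Set.mem_univ _⟩

/-- If some point containing `C` refutes `σ(B)`, then a modification of `σ` strictly shrinks the
failure data: the extension property repairs all points with a given maximal data at once. -/
theorem exists_failureData_ssubset [Finite P] {B C : Formula V P} {σ : Subst V P}
    (hext : HasExtension B C) (hC : C.atoms ⊆ Set.range Sum.inr) (hσ : IsProjectiveSubst B σ)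
    (hne : (failureData B C σ).Nonempty) :
    ∃ σ' : Subst V P, IsProjectiveSubst B σ' ∧ failureData B C σ' ⊂ failureData B C σ := by
  obtain ⟨d, hd⟩ := (finite_failureData B C σ).exists_maximal hne
  obtain ⟨u, hu, hCu, hBu, hdu⟩ := hd.prop
  -- by maximality, a refuting point whose data is at least `d` has exactly the data `d`
  have hmax : ∀ v, IsPrime v → C ∈ v → σ.app B ∉ v → d ≤ pointData B C σ v →
      pointData B C σ v = d := fun v hv hCv hBv hdv =>
    le_antisymm (hd.le_of_ge ⟨v, hv, hCv, hBv, le_rfl⟩ hdv) hdv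
  have hdu' := hmax u hu hCu hBu hdu
  -- what holds, under `σ`, at all the points above `u` that satisfy `σ(B)`
  let T : Set (Formula V P) := {D | imp (σ.app B) (σ.app D) ∈ u}
  have hT : IsTheory T := by
    intro D hD
    refine hu.theory.imp_mem_iff.2 fun v hv huv hBv =>
      (hv.comap σ).theory D (hD.mono fun E hE => ?_)
    exact hv.theory.mp (huv hE) hBv
  have hBT : B ∈ T := hu.theory.imp_mem_iff.2 fun _ _ _ h => h
  have hTd : ∀ E ∈ subf B ++ subf C, ∀ v, pointData B C σ v = d →
      (imp (σ.app B) (σ.app E) ∈ v ↔ E ∈ T) := by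
    intro E hE v hv
    have : E ∈ (pointData B C σ v).1 ↔ E ∈ (pointData B C σ u).1 := by rw [hv, hdu']
    simp only [pointData, Set.mem_ofPred_eq, hE, true_and] at this
    exact this
  have hpd : ∀ p v, pointData B C σ v = d →
      (atom (Sum.inr p) ∈ v ↔ atom (Sum.inr p) ∈ u ∧ atom (Sum.inr p) ∈ T) := by
    intro p v hv
    have : p ∈ (pointData B C σ v).2 ↔ p ∈ (pointData B C σ u).2 := by rw [hv, hdu']
    refine this.trans ⟨fun h => ⟨h, ?_⟩, fun h => h.1⟩
    exact hu.theory.imp_mem_iff.2 fun w _ huw _ => huw h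
  let Y : P → Prop := fun p => atom (Sum.inr p) ∈ u
  have hCslash : Slash (Sum.elim (fun _ => False) Y) T C := by
    refine (app_mem_iff_slash (σ := σ) (σ' := σ) (B := B) (u := u) ?_ (fun _ _ _ _ => Iff.rfl) ?_
      u hu subset_rfl hBu).1 ?_
    · intro E hE v hv huv hBv
      exact hTd E (List.mem_append_right _ hE) v
        (hmax v hv (huv hCu) hBv (hdu.trans (pointData_mono B C σ huv)))
    · intro a ha v hv huv hBv
      obtain ⟨p, rfl⟩ := hC ha
      exact hpd p v (hmax v hv (huv hCu) hBv (hdu.trans (pointData_mono B C σ huv)))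
    · rwa [σ.app_eq_self hC]
  obtain ⟨X, hX⟩ := hext T hT hBT Y hCslash
  have hmod := fun D v hv hB => σ.modify_mem_iff B X D (v := v) hv hB
  -- the points that satisfy `σ(B)` still satisfy `σ'(B)`, so the data can only decrease
  have hle : ∀ v, IsPrime v → pointData B C (σ.modify B X) v ≤ pointData B C σ v := by
    refine fun v hv => ⟨fun D hD => ⟨hD.1, ?_⟩, fun _ hp => hp⟩
    refine hv.theory.imp_mem_iff.2 fun w hw hvw hBw => (hmod D w hw hBw).1 ?_
    exact hw.theory.mp (hvw hD.2) ((hmod B w hw hBw).2 hBw)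
  have hfail : ∀ v, IsPrime v → (σ.modify B X).app B ∉ v → σ.app B ∉ v :=
    fun v hv h h' => h ((hmod B v hv h').2 h')
  refine ⟨σ.modify B X, isProjectiveSubst_of_forall fun x v hv hBv => ?_, ?_, fun hsub => ?_⟩
  · rw [← hσ.app_mem_iff (atom (Sum.inl x)) hv hBv]
    exact hmod (atom (Sum.inl x)) v hv ((hσ.app_mem_iff B hv hBv).2 hBv)
  · rintro e ⟨v, hv, hCv, hBv, hev⟩
    exact ⟨v, hv, hCv, hfail v hv hBv, hev.trans (hle v hv)⟩
  · -- a point refuting `σ'(B)` with data at least `d` would look like the root at which `B` holds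
    obtain ⟨v, hv, hCv, hBv, hdv⟩ := hsub hd.prop
    have hdv' : ∀ w, IsPrime w → v ⊆ w → σ.app B ∉ w → pointData B C σ w = d :=
      fun w hw hvw hBw => hmax w hw (hvw hCv) hBw
        ((hdv.trans (hle v hv)).trans (pointData_mono B C σ hvw))
    refine hBv ((app_mem_iff_slash (σ := σ) (B := B) (u := v) ?_ (fun w hw hBw E => hmod E w hw hBw)
      ?_ v hv subset_rfl (hfail v hv hBv)).2 hX)
    · intro E hE w hw hvw hBw
      exact hTd E (List.mem_append_left _ hE) w (hdv' w hw hvw hBw)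
    · rintro (x | p) ha w hw hvw hBw
      · have hxB : atom (Sum.inl x) ∈ subf B := by
          clear * - ha
          induction B with
          | atom a => cases ha; exact self_mem_subf _
          | bot => exact ha.elim
          | and D E ihD ihE | or D E ihD ihE | imp D E ihD ihE =>
            rcases ha with ha | ha
            · simp [subf, ihD ha]
            · simp [subf, ihE ha]
        have h1 := hTd _ (List.mem_append_left _ hxB) w (hdv' w hw hvw hBw)
        by_cases hx : X x
        · simpa [Subst.app, Subst.modify, hx] using h1
        · simp [Subst.app, Subst.modify, hx, hw.theory.and_mem_iff, hBw]
      · exact hpd p w (hdv' w hw hvw hBw)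

/-- A formula with the extension property relative to a formula `C` in the parameters has a
projective substitution that makes it a consequence of `C`. -/
theorem HasExtension.exists_isProjectiveSubst [Finite P] {B C : Formula V P}
    (hext : HasExtension B C) (hC : C.atoms ⊆ Set.range Sum.inr) :
    ∃ σ : Subst V P, IsProjectiveSubst B σ ∧ Provable (imp C (σ.app B)) := by
  have key : ∀ n, ∀ σ : Subst V P, IsProjectiveSubst B σ → (failureData B C σ).ncard = n →
      ∃ σ : Subst V P, IsProjectiveSubst B σ ∧ failureData B C σ = ∅ := by
    intro n
    induction n using Nat.strong_induction_on with
    | _ n ih =>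
      intro σ hσ hn
      rcases (failureData B C σ).eq_empty_or_nonempty with h | h
      · exact ⟨σ, hσ, h⟩
      · obtain ⟨σ', hσ', hlt⟩ := exists_failureData_ssubset hext hC hσ h
        exact ih _ (hn ▸ Set.ncard_lt_ncard hlt (finite_failureData B C σ)) σ' hσ' rfl
  obtain ⟨σ, hσ, hempty⟩ := key _ (fun x => atom (Sum.inl x))
    (isProjectiveSubst_of_forall fun _ _ _ _ => Iff.rfl) rfl
  refine ⟨σ, hσ, provable_imp_iff.2 fun u hu hCu => ?_⟩
  by_contra hBu
  exact hempty.subset ⟨u, hu, hCu, hBu, le_rfl⟩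

theorem HasExtension.isProjective [Finite P] {Γ : Set (Formula V P)} {B C : Formula V P}
    (hext : HasExtension B C) (hC : C.atoms ⊆ Set.range Sum.inr) (hCΓ : C ∈ Γ)
    (hBC : Provable (imp B C)) : IsProjective Γ B := by
  obtain ⟨σ, hσ, h⟩ := hext.exists_isProjectiveSubst hC
  have h' : Provable (imp (σ.app B) C) := by
    simpa only [Subst.app, σ.app_eq_self hC] using hBC.subst σ
  exact ⟨σ, hσ, C, hCΓ, .andI h' h⟩

/-! ### Formulas of bounded implication depth -/

theorem impDepth_imp (A B : Formula V P) :
    (A = bot ∧ B = bot ∧ (imp A B).impDepth = 0) ∨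
      (imp A B).impDepth = 1 + max A.impDepth B.impDepth := by
  cases A <;> cases B <;> first | exact Or.inl ⟨rfl, rfl, rfl⟩ | exact Or.inr rfl

theorem impDepth_imp_le (A B : Formula V P) :
    (imp A B).impDepth ≤ 1 + max A.impDepth B.impDepth := by
  rcases impDepth_imp A B with h | h <;> omega

theorem impDepth_of_imp_le_succ {A B : Formula V P} {n : ℕ} (h : (imp A B).impDepth ≤ n + 1) :
    A.impDepth ≤ n ∧ B.impDepth ≤ n := by
  rcases impDepth_imp A B with ⟨rfl, rfl, -⟩ | h
  · simp [impDepth]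
  · omega

theorem impDepth_listConj_le {l : List (Formula V P)} {n : ℕ} (h : ∀ A ∈ l, A.impDepth ≤ n) :
    (listConj l).impDepth ≤ n := by
  induction l with
  | nil => simp [listConj, top, impDepth]
  | cons A l ih => simp_all [listConj, impDepth]

theorem impDepth_listDisj_le {l : List (Formula V P)} {n : ℕ} (h : ∀ A ∈ l, A.impDepth ≤ n) :
    (listDisj l).impDepth ≤ n := by
  induction l with
  | nil => simp [listDisj, impDepth]
  | cons A l ih => simp_all [listDisj, impDepth]

/-- All disjunctions of conjunctions of members of `G`. -/
def dnf (G : List (Formula V P)) : List (Formula V P) :=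
  ((G.sublists'.map listConj).sublists').map listDisj

theorem impDepth_le_of_mem_dnf {G : List (Formula V P)} {n : ℕ} (h : ∀ A ∈ G, A.impDepth ≤ n)
    {D : Formula V P} (hD : D ∈ dnf G) : D.impDepth ≤ n := by
  simp only [dnf, List.mem_map, List.mem_sublists'] at hD
  obtain ⟨l, hl, rfl⟩ := hD
  refine impDepth_listDisj_le fun E hE => ?_
  obtain ⟨l', hl', rfl⟩ := List.mem_map.1 (hl.subset hE)
  exact impDepth_listConj_le fun F hF => h F ((List.mem_sublists'.1 hl').subset hF)

/-- A formula is equivalent to a member of `dnf G` if at every point where it holds it follows from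
members of `G` that hold there. -/
theorem exists_mem_dnf {G : List (Formula V P)} {D : Formula V P}
    (h : ∀ u, IsPrime u → D ∈ u → ∃ l : List (Formula V P),
      l.Sublist G ∧ (∀ E ∈ l, E ∈ u) ∧ Prov {E | E ∈ l} D) :
    ∃ E ∈ dnf G, ∀ u, IsPrime u → (D ∈ u ↔ E ∈ u) := by
  classical
  refine ⟨listDisj ((G.sublists'.map listConj).filter fun E => Prov {E} D),
    List.mem_map_of_mem (List.mem_sublists'.2 List.filter_sublist), fun u hu => ?_⟩
  simp only [hu.listDisj_mem_iff, List.mem_filter, decide_eq_true_eq]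
  constructor
  · intro hD
    obtain ⟨l, hl, hlu, hp⟩ := h u hu hD
    refine ⟨listConj l, ⟨List.mem_map_of_mem (List.mem_sublists'.2 hl), ?_⟩,
      hu.theory.listConj_mem_iff.2 hlu⟩
    refine prov_singleton_iff.2 fun v hv hc => hv.theory _ (hp.mono fun E hE => ?_)
    exact hv.theory.listConj_mem_iff.1 hc E hE
  · rintro ⟨E, ⟨-, hE⟩, hEu⟩
    exact prov_singleton_iff.1 hE u hu hEu

/-- Representatives, up to provable equivalence, of the formulas of implication depth at most `n`
over the list of atomic formulas `G`. -/
def reps (G : List (Formula V P)) : ℕ → List (Formula V P)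
  | 0 => dnf G
  | n + 1 => dnf (G ++ (reps G n).flatMap fun D => (reps G n).map (imp D))

theorem impDepth_le_of_mem_reps {G : List (Formula V P)} (hG : ∀ A ∈ G, A.impDepth = 0) (n : ℕ) :
    ∀ D ∈ reps G n, D.impDepth ≤ n := by
  induction n with
  | zero => exact fun D hD => impDepth_le_of_mem_dnf (fun A hA => (hG A hA).le) hD
  | succ n ih =>
    intro D hD
    refine impDepth_le_of_mem_dnf (fun A hA => ?_) hD
    simp only [List.mem_append, List.mem_flatMap, List.mem_map] at hA
    rcases hA with hA | ⟨E, hE, F, hF, rfl⟩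
    · simp [hG A hA]
    · have := impDepth_imp_le E F
      have := ih E hE
      have := ih F hF
      omega

theorem exists_mem_reps {G : List (Formula V P)} (hG : ∀ a, atom a ∈ G) (n : ℕ) (D : Formula V P)
    (hD : D.impDepth ≤ n) : ∃ E ∈ reps G n, ∀ u, IsPrime u → (D ∈ u ↔ E ∈ u) := by
  classical
  have key : ∀ G' : List (Formula V P), (∀ a, atom a ∈ G') →
      ∀ D : Formula V P, (∀ A B, (imp A B).impDepth ≤ D.impDepth →
        ∃ E, (E = top ∨ E ∈ G') ∧ ∀ u, IsPrime u → (imp A B ∈ u ↔ E ∈ u)) →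
      ∃ E ∈ dnf G', ∀ u, IsPrime u → (D ∈ u ↔ E ∈ u) := by
    intro G' hG' D hD
    refine exists_mem_dnf fun u hu hDu => ⟨G'.filter (· ∈ u), List.filter_sublist,
      fun E hE => by simpa using (List.mem_filter.1 hE).2, ?_⟩
    induction D with
    | atom a => exact .hyp (List.mem_filter.2 ⟨hG' a, by simpa using hDu⟩)
    | bot => exact (hu.bot hDu).elim
    | and A B ihA ihB =>
      have h := hu.theory.and_mem_iff.1 hDu
      exact .andI (ihA (fun E F h => hD E F (h.trans (le_max_left _ _))) h.1)
        (ihB (fun E F h => hD E F (h.trans (le_max_right _ _))) h.2)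
    | or A B ihA ihB =>
      rcases hu.or_mem_iff.1 hDu with h | h
      · exact .orI₁ (ihA (fun E F h => hD E F (h.trans (le_max_left _ _))) h)
      · exact .orI₂ (ihB (fun E F h => hD E F (h.trans (le_max_right _ _))) h)
    | imp A B _ _ =>
      obtain ⟨E, hE, hEu⟩ := hD A B le_rfl
      refine prov_iff_forall_isPrime.2 fun v hv hlv => (hEu v hv).2 ?_
      rcases hE with rfl | hE
      · exact hv.theory.top_mem
      · exact hlv (List.mem_filter.2 ⟨hE, by simpa using (hEu u hu).1 hDu⟩)
  induction n generalizing D with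
  | zero =>
    refine key G hG D fun A B hAB => ⟨top, Or.inl rfl, ?_⟩
    rcases impDepth_imp A B with ⟨rfl, rfl, -⟩ | h
    · exact fun _ _ => Iff.rfl
    · omega
  | succ n ih =>
    refine key _ (fun a => List.mem_append_left _ (hG a)) D fun A B hAB => ?_
    obtain ⟨hA, hB⟩ := impDepth_of_imp_le_succ (hAB.trans hD)
    obtain ⟨A', hA', hAA'⟩ := ih A hA
    obtain ⟨B', hB', hBB'⟩ := ih B hB
    refine ⟨imp A' B', Or.inr (List.mem_append_right _ (List.mem_flatMap.2
      ⟨A', hA', List.mem_map_of_mem hB'⟩)), fun u hu => ?_⟩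
    rw [hu.theory.imp_mem_iff, hu.theory.imp_mem_iff]
    exact forall_congr' fun v => forall_congr' fun hv => by rw [hAA' v hv, hBB' v hv]

/-! ### The implication depth of NNIL formulas -/

/-- `C` is equivalent, under the assumption of the parameters in `X`, to an `NNIL` formula in the
parameters whose implication depth is at most the number of parameters outside `X`. -/
def IsReducible [Fintype P] (C : Formula V P) : Prop :=
  ∀ X : Finset P, ∃ C' ∈ NNILpar V P, C'.impDepth ≤ Fintype.card P - X.card ∧
    ∀ u, IsPrime u → (∀ p ∈ X, atom (Sum.inr p) ∈ u) → (C ∈ u ↔ C' ∈ u)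

theorem and_mem_NNILpar {A B : Formula V P} (hA : A ∈ NNILpar V P) (hB : B ∈ NNILpar V P) :
    Formula.and A B ∈ NNILpar V P :=
  ⟨hA.1.and hB.1, Set.union_subset hA.2 hB.2⟩

theorem IsReducible.congr [Fintype P] {C D : Formula V P} (hC : IsReducible C)
    (h : ∀ u, IsPrime u → (D ∈ u ↔ C ∈ u)) : IsReducible D := fun X =>
  let ⟨C', h1, h2, h3⟩ := hC X
  ⟨C', h1, h2, fun u hu hX => (h u hu).trans (h3 u hu hX)⟩

theorem IsReducible.and [Fintype P] {C D : Formula V P} (hC : IsReducible C) (hD : IsReducible D) :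
    IsReducible (Formula.and C D) := by
  intro X
  obtain ⟨C', hC1, hC2, hC3⟩ := hC X
  obtain ⟨D', hD1, hD2, hD3⟩ := hD X
  refine ⟨Formula.and C' D', and_mem_NNILpar hC1 hD1, max_le hC2 hD2, fun u hu hX => ?_⟩
  rw [hu.theory.and_mem_iff, hu.theory.and_mem_iff, hC3 u hu hX, hD3 u hu hX]

theorem IsReducible.or [Fintype P] {C D : Formula V P} (hC : IsReducible C) (hD : IsReducible D) :
    IsReducible (Formula.or C D) := by
  intro X
  obtain ⟨C', hC1, hC2, hC3⟩ := hC X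
  obtain ⟨D', hD1, hD2, hD3⟩ := hD X
  refine ⟨Formula.or C' D', ⟨hC1.1.or hD1.1, Set.union_subset hC1.2 hD1.2⟩, max_le hC2 hD2,
    fun u hu hX => ?_⟩
  rw [hu.or_mem_iff, hu.or_mem_iff, hC3 u hu hX, hD3 u hu hX]

/-- Below an antecedent `p` that is not yet assumed, the consequent may be reduced under the
additional assumption `p`, which lowers its depth by one. -/
theorem IsReducible.imp [Fintype P] {D E : Formula V P} (hD : IsNI D)
    (hDp : D.atoms ⊆ Set.range Sum.inr) (hE : IsReducible E) : IsReducible (imp D E) := by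
  classical
  induction hD generalizing E with
  | atom a =>
    obtain ⟨p, rfl⟩ := hDp rfl
    intro X
    by_cases hp : p ∈ X
    · obtain ⟨E', h1, h2, h3⟩ := hE X
      refine ⟨E', h1, h2, fun u hu hX => ?_⟩
      rw [← h3 u hu hX]
      exact ⟨fun h => hu.theory.mp h (hX p hp),
        fun h => hu.theory.imp_mem_iff.2 fun v _ huv _ => huv h⟩
    · obtain ⟨E', h1, h2, h3⟩ := hE (insert p X)
      refine ⟨Formula.imp (atom (Sum.inr p)) E', ⟨.imp (.atom _) h1.1,
        Set.union_subset (by rintro _ rfl; exact ⟨p, rfl⟩) h1.2⟩, ?_, fun u hu hX => ?_⟩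
      · have hcard := (insert p X).card_le_univ
        rw [Finset.card_insert_of_notMem hp] at h2 hcard
        have := impDepth_imp_le (atom (Sum.inr p)) E'
        have h0 : (atom (Sum.inr p) : Formula V P).impDepth = 0 := rfl
        omega
      · rw [hu.theory.imp_mem_iff, hu.theory.imp_mem_iff]
        refine forall_congr' fun v => forall_congr' fun hv => forall_congr' fun huv =>
          forall_congr' fun hpv => h3 v hv fun q hq => ?_
        rcases Finset.mem_insert.1 hq with rfl | hq
        exacts [hpv, huv (hX q hq)]
  | bot =>
    refine fun X => ⟨top, ⟨.imp .bot .bot, by simp [top, atoms]⟩, Nat.zero_le _,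
      fun u hu _ => iff_of_true ?_ hu.theory.top_mem⟩
    exact hu.theory.imp_mem_iff.2 fun v hv _ h => (hv.bot h).elim
  | @and A B _ _ ihA ihB =>
    refine (ihA (Set.subset_union_left.trans hDp) (ihB (Set.subset_union_right.trans hDp) hE)).congr
      fun u hu => ?_
    simp only [hu.theory.imp_mem_iff]
    refine ⟨fun h v hv huv hA => hv.theory.imp_mem_iff.2 fun w hw hvw hB =>
      h w hw (huv.trans hvw) (hw.theory.and_mem_iff.2 ⟨hvw hA, hB⟩), fun h v hv huv hAB => ?_⟩
    have hAB := hv.theory.and_mem_iff.1 hAB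
    exact hv.theory.mp (h v hv huv hAB.1) hAB.2
  | @or A B _ _ ihA ihB =>
    refine ((ihA (Set.subset_union_left.trans hDp) hE).and
      (ihB (Set.subset_union_right.trans hDp) hE)).congr fun u hu => ?_
    simp only [hu.theory.imp_mem_iff, hu.theory.and_mem_iff]
    refine ⟨fun h => ⟨fun v hv huv hA => h v hv huv (hv.or_mem_iff.2 (Or.inl hA)),
      fun v hv huv hB => h v hv huv (hv.or_mem_iff.2 (Or.inr hB))⟩, fun h v hv huv hAB => ?_⟩
    exact (hv.or_mem_iff.1 hAB).elim (h.1 v hv huv) (h.2 v hv huv)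

theorem isReducible_of_mem_NNILpar [Fintype P] {C : Formula V P} (hC : C ∈ NNILpar V P) :
    IsReducible C := by
  obtain ⟨hC, hp⟩ := hC
  induction hC with
  | atom a =>
    exact fun X => ⟨atom a, ⟨.atom a, hp⟩, Nat.zero_le _, fun _ _ _ => Iff.rfl⟩
  | bot => exact fun X => ⟨bot, ⟨.bot, hp⟩, Nat.zero_le _, fun _ _ _ => Iff.rfl⟩
  | and _ _ ihA ihB =>
    exact (ihA (Set.subset_union_left.trans hp)).and (ihB (Set.subset_union_right.trans hp))
  | or _ _ ihA ihB =>
    exact (ihA (Set.subset_union_left.trans hp)).or (ihB (Set.subset_union_right.trans hp))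
  | imp hA _ ihB =>
    exact IsReducible.imp hA (Set.subset_union_left.trans hp)
      (ihB (Set.subset_union_right.trans hp))

/-- Up to provable equivalence, there are finitely many `NNIL` formulas in the parameters, all of
implication depth at most the number of parameters. -/
theorem exists_list_NNILpar [Fintype P] {G : List (Formula V P)} (hG : ∀ a, atom a ∈ G) :
    ∃ L : List (Formula V P), (∀ C ∈ L, C ∈ NNILpar V P ∧ C.impDepth ≤ Fintype.card P) ∧
      ∀ C ∈ NNILpar V P, ∃ C' ∈ L, ∀ u, IsPrime u → (C ∈ u ↔ C' ∈ u) := by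
  classical
  let Q : Formula V P → Formula V P → Prop := fun E C =>
    (C ∈ NNILpar V P ∧ C.impDepth ≤ Fintype.card P) ∧ ∀ u, IsPrime u → (E ∈ u ↔ C ∈ u)
  refine ⟨(reps G (Fintype.card P)).flatMap fun E => if h : ∃ C, Q E C then [h.choose] else [],
    fun C hC => ?_, fun C hC => ?_⟩
  · obtain ⟨E, -, hE⟩ := List.mem_flatMap.1 hC
    split_ifs at hE with h
    · rw [List.mem_singleton.1 hE]
      exact h.choose_spec.1
    · simp at hE
  · obtain ⟨C', h1, h2, h3⟩ := isReducible_of_mem_NNILpar hC ∅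
    obtain ⟨E, hE, hCE⟩ := exists_mem_reps hG _ C' (by simpa using h2)
    have h : ∃ C, Q E C := ⟨C', ⟨h1, by simpa using h2⟩, fun u hu => (hCE u hu).symm⟩
    refine ⟨h.choose, List.mem_flatMap.2 ⟨E, hE, by simp [h]⟩, fun u hu => ?_⟩
    rw [h3 u hu (by simp), hCE u hu, h.choose_spec.2 u hu]

/-! ### The extension property of the consequences of a substitution -/

/-- Let `B` axiomatize the formulas `D` of depth at most `n + 1` such that `C ⊢ θ(D)`.  Then each
point containing `B` agrees, on the formulas of depth at most `n`, with the pullback along `θ` of a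
point containing `C`; otherwise the implication from the conjunction of the depth `n` formulas true
at the point to the disjunction of the false ones would be a consequence of `B`. -/
theorem exists_isPrime_app_mem_iff {G : List (Formula V P)} (hG : ∀ a, atom a ∈ G)
    (hG0 : ∀ A ∈ G, A.impDepth = 0) {n : ℕ} {B C : Formula V P} {θ : Subst V P}
    (hB : ∀ D : Formula V P, D.impDepth ≤ n + 1 → Provable (imp C (θ.app D)) → Provable (imp B D))
    {s : Set (Formula V P)} (hs : IsPrime s) (hBs : B ∈ s) :
    ∃ u, IsPrime u ∧ C ∈ u ∧ ∀ D : Formula V P, D.impDepth ≤ n → (θ.app D ∈ u ↔ D ∈ s) := by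
  classical
  let l₁ := (reps G n).filter (· ∈ s)
  let l₂ := (reps G n).filter (· ∉ s)
  have hd : (imp (listConj l₁) (listDisj l₂)).impDepth ≤ n + 1 := by
    have h1 : (listConj l₁).impDepth ≤ n := impDepth_listConj_le fun A hA =>
      impDepth_le_of_mem_reps hG0 n A (List.mem_filter.1 hA).1
    have h2 : (listDisj l₂).impDepth ≤ n := impDepth_listDisj_le fun A hA =>
      impDepth_le_of_mem_reps hG0 n A (List.mem_filter.1 hA).1
    have := impDepth_imp_le (listConj l₁) (listDisj l₂)
    omega
  have hn : ¬ Provable (imp C (θ.app (imp (listConj l₁) (listDisj l₂)))) := by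
    intro h
    have h := hs.theory.mp (provable_imp_iff.1 (hB _ hd h) s hs hBs)
      (hs.theory.listConj_mem_iff.2 fun A hA => by simpa using (List.mem_filter.1 hA).2)
    obtain ⟨A, hA, hAs⟩ := hs.listDisj_mem_iff.1 h
    exact (by simpa using (List.mem_filter.1 hA).2 : A ∉ s) hAs
  rw [provable_imp_iff] at hn
  push Not at hn
  obtain ⟨v, hv, hCv, hn⟩ := hn
  simp only [Subst.app, hv.theory.imp_mem_iff] at hn
  push Not at hn
  obtain ⟨u, hu, hvu, h1, h2⟩ := hn
  have hu' := hu.comap θ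
  refine ⟨u, hu, hvu hCv, fun D hD => ?_⟩
  obtain ⟨E, hE, hDE⟩ := exists_mem_reps hG n D hD
  rw [hDE s hs]
  refine (hDE _ hu').trans ?_
  by_cases hEs : E ∈ s
  · exact iff_of_true (hu'.theory.listConj_mem_iff.1 h1 E (List.mem_filter.2 ⟨hE, by simpa⟩)) hEs
  · exact iff_of_false (fun h => h2 (hu'.listDisj_mem_iff.2
      ⟨E, List.mem_filter.2 ⟨hE, by simpa⟩, h⟩)) hEs

/-- A formula `B` axiomatizing the formulas `D` of depth at most `n + 1` such that `C ⊢ θ(D)` has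
the extension property relative to `C`.  Given a root over a theory `T`, each point above `T` is
replaced by a point containing `C` that matches it under `θ`; the value under `θ` of the variables at the
root of the resulting model is the required valuation. -/
theorem hasExtension_of_app {G : List (Formula V P)} (hG : ∀ a, atom a ∈ G)
    (hG0 : ∀ A ∈ G, A.impDepth = 0) {n : ℕ} {B C : Formula V P} {θ : Subst V P}
    (hCp : C.atoms ⊆ Set.range Sum.inr) (hCn : C.impDepth ≤ n) (hBn : B.impDepth ≤ n + 1)
    (hB : ∀ D : Formula V P, D.impDepth ≤ n + 1 → Provable (imp C (θ.app D)) → Provable (imp B D))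
    (hCB : Provable (imp C (θ.app B))) : HasExtension B C := by
  intro T hT hBT Y hY
  have hex : ∀ s : {s // IsPrime s ∧ T ⊆ s}, ∃ u, IsPrime u ∧ C ∈ u ∧
      ∀ D : Formula V P, D.impDepth ≤ n → (θ.app D ∈ u ↔ D ∈ s.1) := fun s =>
    exists_isPrime_app_mem_iff hG hG0 hB s.2.1 (s.2.2 hBT)
  choose u hu hCu hus using hex
  -- the root below all the points `u s`, with the given values of the parameters
  let T' : Set (Formula V P) := {D | ∀ s, D ∈ u s}
  have hT' : IsTheory T' := fun D hD s => (hu s).theory _ (hD.mono fun E hE => hE s)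
  have hTT' : ∀ D : Formula V P, D.impDepth ≤ n → (θ.app D ∈ T' ↔ D ∈ T) := by
    intro D hD
    rw [hT.mem_iff]
    exact ⟨fun h s hs hTs => (hus ⟨s, hs, hTs⟩ D hD).1 (h _),
      fun h s => (hus s D hD).2 (h s.1 s.2.1 s.2.2)⟩
  let n₀ : Formula V P → Prop := Slash (Sum.elim (fun _ => False) Y) T'
  have hCn₀ : n₀ C := by
    have key : ∀ D : Formula V P, D.atoms ⊆ Set.range Sum.inr → D.impDepth ≤ n →
        (n₀ D ↔ Slash (Sum.elim (fun _ => False) Y) T D) := by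
      intro D hDp hDn
      induction D with
      | atom a =>
        have := hTT' _ hDn
        rw [θ.app_eq_self hDp] at this
        simp only [n₀, Slash, this]
      | bot => rfl
      | and D E ihD ihE | or D E ihD ihE =>
        have h1 := ihD (Set.subset_union_left.trans hDp) ((le_max_left _ _).trans hDn)
        have h2 := ihE (Set.subset_union_right.trans hDp) ((le_max_right _ _).trans hDn)
        simp only [n₀, Slash] at *
        rw [h1, h2]
      | imp D E ihD ihE =>
        have hDE := impDepth_of_imp_le_succ (hDn.trans n.le_succ)
        have h1 := ihD (Set.subset_union_left.trans hDp) hDE.1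
        have h2 := ihE (Set.subset_union_right.trans hDp) hDE.2
        have h3 := hTT' _ hDn
        rw [θ.app_eq_self hDp] at h3
        simp only [n₀, Slash] at *
        rw [h1, h2, h3]
    exact (key C hCp hCn).2 hY
  let X : V → Prop := fun x => n₀ (θ x)
  let w : Formula V P → Prop := Slash (Sum.elim X Y) T
  have hwn : ∀ D : Formula V P, D.impDepth ≤ n → (w D ↔ n₀ (θ.app D)) := by
    intro D hDn
    induction D with
    | atom a =>
      rcases a with x | p
      · have := hTT' _ hDn
        exact ⟨fun h => h.1, fun h => ⟨h, this.1 (h.mem hT')⟩⟩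
      · have := hTT' _ hDn
        simp only [Subst.app] at this
        simp only [w, n₀, Subst.app, Slash, this, Sum.elim_inr]
    | bot => rfl
    | and D E ihD ihE | or D E ihD ihE =>
      have h1 := ihD ((le_max_left _ _).trans hDn)
      have h2 := ihE ((le_max_right _ _).trans hDn)
      simp only [w, n₀, Slash, Subst.app] at *
      rw [h1, h2]
    | imp D E ihD ihE =>
      have hDE := impDepth_of_imp_le_succ (hDn.trans n.le_succ)
      have h1 := ihD hDE.1
      have h2 := ihE hDE.2
      have h3 := hTT' _ hDn
      simp only [w, n₀, Slash, Subst.app] at *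
      rw [h1, h2, h3]
  -- for formulas of depth `n + 1` only one direction survives
  have hw : ∀ D : Formula V P, D.impDepth ≤ n + 1 → n₀ (θ.app D) → w D := by
    intro D hDn h
    induction D with
    | atom a => exact (hwn _ (Nat.zero_le _)).2 h
    | bot => exact h
    | and D E ihD ihE =>
      exact ⟨ihD ((le_max_left _ _).trans hDn) h.1, ihE ((le_max_right _ _).trans hDn) h.2⟩
    | or D E ihD ihE =>
      exact h.imp (ihD ((le_max_left _ _).trans hDn)) (ihE ((le_max_right _ _).trans hDn))
    | imp D E ihD ihE =>
      obtain ⟨hD, hE⟩ := impDepth_of_imp_le_succ hDn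
      refine ⟨fun hwD => (hwn E hE).2 (h.1 ((hwn D hD).1 hwD)), hT.imp_mem_iff.2 ?_⟩
      intro s hs hTs hDs
      have hus' := hus ⟨s, hs, hTs⟩
      exact (hus' E hE).1 ((hu _).theory.mp (h.2 _) ((hus' D hD).2 hDs))
  refine ⟨X, hw B hBn (Slash.of_prov hT' (prov_imp_iff.1 hCB) ?_)⟩
  simpa using hCn₀

/-- If `C ⊢ θ(A)`, then some formula of the same bounded depth implies `A`, has the extension
property relative to `C`, and is made a consequence of `C` by `θ`. -/
theorem exists_hasExtension {G : List (Formula V P)} (hG : ∀ a, atom a ∈ G)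
    (hG0 : ∀ A ∈ G, A.impDepth = 0) {n : ℕ} {A C : Formula V P} {θ : Subst V P}
    (hCp : C.atoms ⊆ Set.range Sum.inr) (hCn : C.impDepth ≤ n) (hAn : A.impDepth ≤ n + 1)
    (hCA : Provable (imp C (θ.app A))) :
    ∃ B ∈ reps G (n + 1), HasExtension B C ∧ Provable (imp B C) ∧ Provable (imp B A) ∧
      Provable (imp C (θ.app B)) := by
  classical
  let l := (reps G (n + 1)).filter fun D => Provable (imp C (θ.app D))
  have hl : (listConj l).impDepth ≤ n + 1 := impDepth_listConj_le fun D hD =>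
    impDepth_le_of_mem_reps hG0 _ D (List.mem_filter.1 hD).1
  obtain ⟨B, hBm, hlB⟩ := exists_mem_reps hG _ _ hl
  have hB : ∀ D : Formula V P, D.impDepth ≤ n + 1 → Provable (imp C (θ.app D)) →
      Provable (imp B D) := by
    intro D hDn hCD
    obtain ⟨E, hE, hDE⟩ := exists_mem_reps hG _ D hDn
    refine provable_imp_iff.2 fun u hu hBu => (hDE u hu).2 ?_
    refine hu.theory.listConj_mem_iff.1 ((hlB u hu).2 hBu) E (List.mem_filter.2 ⟨hE, ?_⟩)
    simp only [decide_eq_true_eq, provable_imp_iff] at hCD ⊢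
    exact fun v hv hCv => (hDE _ (hv.comap θ)).1 (hCD v hv hCv)
  have hCB : Provable (imp C (θ.app B)) := by
    refine provable_imp_iff.2 fun u hu hCu => (hlB _ (hu.comap θ)).1 ?_
    refine (hu.comap θ).theory.listConj_mem_iff.2 fun D hD => ?_
    exact provable_imp_iff.1 (by simpa using (List.mem_filter.1 hD).2) u hu hCu
  refine ⟨B, hBm, hasExtension_of_app hG hG0 hCp hCn (impDepth_le_of_mem_reps hG0 _ B hBm) hB hCB,
    hB C (hCn.trans n.le_succ) ?_, hB A hAn hCA, hCB⟩
  rw [θ.app_eq_self hCp]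
  exact provable_imp_iff.2 fun _ _ h => h

/-! ### The finite model property -/

section FiniteModels

variable [DecidableEq V] [DecidableEq P]

/-- A finite list of lists of formulas is read as a Kripke model: its worlds are the members,
ordered by inclusion, and an atom holds at the worlds that contain it.  Every such list is a model, so no
side condition is needed.  `truth M A` lists the worlds of `M` at which `A` holds. -/
def truth (M : List (List (Formula V P))) : Formula V P → List (List (Formula V P))
  | atom a => M.filter fun w => atom a ∈ w
  | bot => []
  | Formula.and A B => M.filter fun w => w ∈ truth M A ∧ w ∈ truth M B
  | Formula.or A B => M.filter fun w => w ∈ truth M A ∨ w ∈ truth M B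
  | imp A B => M.filter fun w => ∀ v ∈ M, w ⊆ v → v ∈ truth M A → v ∈ truth M B

theorem truth_mono {M : List (List (Formula V P))} {A : Formula V P} {v w : List (Formula V P)}
    (hv : v ∈ M) (hwv : w ⊆ v) (h : w ∈ truth M A) : v ∈ truth M A := by
  induction A with
  | atom a => simp_all [truth]; exact hwv h.2
  | bot => simp [truth] at h
  | and A B ihA ihB => simp_all [truth]
  | or A B ihA ihB => simp_all [truth]; exact h.2.imp ihA ihB
  | imp A B _ _ =>
    simp only [truth, List.mem_filter, decide_eq_true_eq] at h ⊢
    exact ⟨hv, fun x hx hvx => h.2 x hx (List.Subset.trans hwv hvx)⟩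

theorem Prov.mem_truth {M : List (List (Formula V P))} {Γ : Set (Formula V P)} {A : Formula V P}
    (h : Prov Γ A) : ∀ w ∈ M, (∀ B ∈ Γ, w ∈ truth M B) → w ∈ truth M A := by
  induction h with
  | hyp h => exact fun w _ hΓ => hΓ _ h
  | botE _ ih => exact fun w hw hΓ => by simpa [truth] using ih w hw hΓ
  | andI _ _ ih₁ ih₂ => exact fun w hw hΓ => by simp [truth, hw, ih₁ w hw hΓ, ih₂ w hw hΓ]
  | andE₁ _ ih =>
    intro w hw hΓ
    have := ih w hw hΓ
    simp only [truth, List.mem_filter, decide_eq_true_eq] at this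
    exact this.2.1
  | andE₂ _ ih =>
    intro w hw hΓ
    have := ih w hw hΓ
    simp only [truth, List.mem_filter, decide_eq_true_eq] at this
    exact this.2.2
  | orI₁ _ ih => exact fun w hw hΓ => by simp [truth, hw, ih w hw hΓ]
  | orI₂ _ ih => exact fun w hw hΓ => by simp [truth, hw, ih w hw hΓ]
  | orE _ _ _ ih ih₁ ih₂ =>
    intro w hw hΓ
    have := ih w hw hΓ
    simp only [truth, List.mem_filter, decide_eq_true_eq] at this
    rcases this.2 with h | h
    · exact ih₁ w hw (by simpa using ⟨h, hΓ⟩)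
    · exact ih₂ w hw (by simpa using ⟨h, hΓ⟩)
  | impI _ ih =>
    intro w hw hΓ
    simp only [truth, List.mem_filter, decide_eq_true_eq]
    refine ⟨hw, fun v hv hwv hA => ih v hv ?_⟩
    simpa using ⟨hA, fun B hB => truth_mono hv hwv (hΓ B hB)⟩
  | impE _ _ ih₁ ih₂ =>
    intro w hw hΓ
    have := ih₁ w hw hΓ
    simp only [truth, List.mem_filter, decide_eq_true_eq] at this
    exact this.2 w hw (List.Subset.refl w) (ih₂ w hw hΓ)

open Classical in
/-- The finite model obtained by intersecting the prime theories with the list `Φ`. -/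
noncomputable def filtration (Φ : List (Formula V P)) : List (List (Formula V P)) :=
  Φ.sublists'.filter fun w => ∃ u, IsPrime u ∧ w = Φ.filter (· ∈ u)

open Classical in
theorem mem_truth_filtration {Φ : List (Formula V P)} {D : Formula V P} (hD : subf D ⊆ Φ)
    {u : Set (Formula V P)} (hu : IsPrime u) :
    Φ.filter (· ∈ u) ∈ truth (filtration Φ) D ↔ D ∈ u := by
  have hmem : ∀ u, IsPrime u → Φ.filter (· ∈ u) ∈ filtration Φ := fun u hu =>
    List.mem_filter.2 ⟨List.mem_sublists'.2 List.filter_sublist, by simpa using ⟨u, hu, rfl⟩⟩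
  induction D generalizing u with
  | atom a =>
    have ha : atom a ∈ Φ := hD (self_mem_subf _)
    simp [truth, hmem u hu, ha]
  | bot => simpa [truth] using hu.bot
  | and A B ihA ihB =>
    simp only [subf, List.cons_subset, List.append_subset] at hD
    simp [truth, hmem u hu, ihA hD.2.1 hu, ihB hD.2.2 hu, hu.theory.and_mem_iff]
  | or A B ihA ihB =>
    simp only [subf, List.cons_subset, List.append_subset] at hD
    simp [truth, hmem u hu, ihA hD.2.1 hu, ihB hD.2.2 hu, hu.or_mem_iff]
  | imp A B ihA ihB =>
    simp only [subf, List.cons_subset, List.append_subset] at hD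
    simp only [truth, List.mem_filter, decide_eq_true_eq, hmem u hu, true_and]
    constructor
    · refine fun h => hu.theory.imp_mem_iff.2 fun v hv huv hA => (ihB hD.2.2 hv).1 ?_
      refine h _ (hmem v hv) (fun x hx => ?_) ((ihA hD.2.1 hv).2 hA)
      simp only [List.mem_filter, decide_eq_true_eq] at hx ⊢
      exact ⟨hx.1, huv hx.2⟩
    · intro h x hx hux hA
      obtain ⟨v, hv, rfl⟩ : ∃ u, IsPrime u ∧ x = Φ.filter (· ∈ u) := by
        simpa using (List.mem_filter.1 hx).2
      have hm : imp A B ∈ Φ.filter (· ∈ v) := hux (List.mem_filter.2 ⟨hD.1, by simpa using h⟩)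
      have hm : imp A B ∈ v := by simpa using (List.mem_filter.1 hm).2
      exact (ihB hD.2.2 hv).2 (hv.theory.mp hm ((ihA hD.2.1 hv).1 hA))

theorem provable_iff_truth {A : Formula V P} :
    Provable A ↔ ∀ M ∈ (subf A).sublists'.sublists', ∀ w ∈ M, w ∈ truth M A := by
  classical
  refine ⟨fun h M _ w hw => h.mem_truth w hw (by simp), fun h => ?_⟩
  refine prov_iff_forall_isPrime.2 fun u hu _ => ?_
  refine (mem_truth_filtration (List.Subset.refl _) hu).1 (h _ ?_ _ ?_)
  · exact List.mem_sublists'.2 List.filter_sublist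
  · exact List.mem_filter.2 ⟨List.mem_sublists'.2 List.filter_sublist, by simpa using ⟨u, hu, rfl⟩⟩

end FiniteModels

/-! ### A finite form of the extension property -/

/-- The extension property of `B` relative to `C`, with the theory replaced by the set `S` of its
members among the subformulas of `B` and `C`, and with `vs` and `ps` listing the variables and the
parameters. -/
def HasFiniteExtension (vs ps : List (Formula V P)) (B C : Formula V P) : Prop :=
  ∀ S ∈ (subf B ++ subf C).sublists',
    (∀ D ∈ subf B ++ subf C, Provable (imp (listConj (B :: S)) D) → D ∈ S) →
    ∀ Y ∈ ps.sublists', Slash (fun a => atom a ∈ Y) {D | D ∈ S} C →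
      ∃ X ∈ vs.sublists', Slash (fun a => atom a ∈ X ++ Y) {D | D ∈ S} B

theorem hasFiniteExtension_iff {vs ps : List (Formula V P)}
    (hvs : ∀ A, A ∈ vs ↔ ∃ x, A = atom (Sum.inl x))
    (hps : ∀ A, A ∈ ps ↔ ∃ p, A = atom (Sum.inr p)) {B C : Formula V P}
    (hC : C.atoms ⊆ Set.range Sum.inr) :
    HasFiniteExtension vs ps B C ↔ HasExtension B C := by
  classical
  constructor
  · intro h T hT hBT Y hY
    let S := (subf B ++ subf C).filter (· ∈ T)
    have hS : ∀ D ∈ subf B ++ subf C, D ∈ S ↔ D ∈ T := fun D hD => by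
      rw [List.mem_filter, decide_eq_true_eq, and_iff_right hD]
    let Y' := ps.filter fun A => ∃ p, A = atom (Sum.inr p) ∧ Y p
    have hY' : ∀ p, atom (Sum.inr p) ∈ Y' ↔ Y p := fun p => by simp [Y', hps]
    have hclosed : ∀ D ∈ subf B ++ subf C, Provable (imp (listConj (B :: S)) D) → D ∈ S := by
      intro D hD hp
      refine (hS D hD).2 (hT.mp (hT _ (hp.mono (Set.empty_subset _))) ?_)
      refine hT.listConj_mem_iff.2 fun E hE => ?_
      rcases List.mem_cons.1 hE with rfl | hE
      · exact hBT
      · simpa using (List.mem_filter.1 hE).2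
    have hslash : Slash (fun a => atom a ∈ Y') {D | D ∈ S} C := by
      refine (slash_congr (fun a ha => ?_) fun D hD =>
        (hS D (List.mem_append_right _ hD)).symm).1 hY
      obtain ⟨p, rfl⟩ := hC ha
      exact (hY' p).symm
    obtain ⟨X, hX, hXB⟩ := h S (List.mem_sublists'.2 List.filter_sublist) hclosed Y'
      (List.mem_sublists'.2 List.filter_sublist) hslash
    refine ⟨fun x => atom (Sum.inl x) ∈ X, (slash_congr ?_ ?_).1 hXB⟩
    · rintro (x | p) -
      · simp [Y', hps]
      · have : atom (Sum.inr p) ∉ X := fun h => by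
          simpa [hvs] using (List.mem_sublists'.1 hX).subset h
        simp [this, hY']
    · exact fun D hD => hS D (List.mem_append_left _ hD)
  · intro h S hS hclosed Y hY hslash
    have hT := isTheory_setOf_prov {D | D ∈ B :: S}
    have hTS : ∀ D ∈ subf B ++ subf C, Prov {D | D ∈ B :: S} D ↔ D ∈ S := by
      refine fun D hD => ⟨fun hp => hclosed D hD (provable_imp_iff.2 fun u hu hc => ?_),
        fun hDS => .hyp (List.mem_cons_of_mem _ hDS)⟩
      exact hu.theory _ (hp.mono fun E hE => hu.theory.listConj_mem_iff.1 hc E hE)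
    have hslash' : Slash (Sum.elim (fun _ => False) fun p => atom (Sum.inr p) ∈ Y)
        {D | Prov {D | D ∈ B :: S} D} C := by
      refine (slash_congr (fun a ha => ?_) fun D hD =>
        (hTS D (List.mem_append_right _ hD)).symm).1 hslash
      obtain ⟨p, rfl⟩ := hC ha
      rfl
    obtain ⟨X, hX⟩ := h _ hT (.hyp List.mem_cons_self) _ hslash'
    refine ⟨vs.filter fun A => ∃ x, A = atom (Sum.inl x) ∧ X x,
      List.mem_sublists'.2 List.filter_sublist, (slash_congr ?_ fun D hD =>
        hTS D (List.mem_append_left _ hD)).1 hX⟩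
    rintro (x | p) -
    · have : atom (Sum.inl x) ∉ Y := fun h => by
        simpa [hps] using (List.mem_sublists'.1 hY).subset h
      simp [hvs, this]
    · simp [hvs]

/-! ### Antichains of maximal formulas -/

open Classical in
/-- A sublist of `l` that is an antichain for provable implication and still lies above every member
of `l`. -/
noncomputable def antichain (l : List (Formula V P)) : List (Formula V P) :=
  l.foldr (fun B r => if ∃ D ∈ r, Provable (imp B D) then r
    else B :: r.filter fun D => ¬ Provable (imp D B)) []

theorem mem_of_mem_antichain {l : List (Formula V P)} {B : Formula V P} (h : B ∈ antichain l) :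
    B ∈ l := by
  induction l with
  | nil => simp [antichain] at h
  | cons C l ih =>
    rw [antichain, List.foldr_cons, ← antichain] at h
    split_ifs at h with hc
    · exact List.mem_cons_of_mem _ (ih h)
    · rcases List.mem_cons.1 h with rfl | h
      · exact List.mem_cons_self
      · exact List.mem_cons_of_mem _ (ih (List.mem_filter.1 h).1)

theorem antichain_independent {l : List (Formula V P)} {B C : Formula V P} (hB : B ∈ antichain l)
    (hC : C ∈ antichain l) (h : Provable (imp B C)) : B = C := by
  induction l with
  | nil => simp [antichain] at hB
  | cons D l ih =>
    rw [antichain, List.foldr_cons, ← antichain] at hB hC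
    split_ifs at hB hC with hD
    · exact ih hB hC
    · simp only [List.mem_cons, List.mem_filter, decide_eq_true_eq] at hB hC
      rcases hB with rfl | hB <;> rcases hC with rfl | hC
      · rfl
      · exact (hD ⟨C, hC.1, h⟩).elim
      · exact (hB.2 h).elim
      · exact ih hB.1 hC.1

theorem exists_mem_antichain {l : List (Formula V P)} {B : Formula V P} (hB : B ∈ l) :
    ∃ C ∈ antichain l, Provable (imp B C) := by
  have htrans : ∀ {A B C : Formula V P}, Provable (imp A B) → Provable (imp B C) →
      Provable (imp A C) := fun h h' => provable_imp_iff.2 fun u hu hA =>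
    provable_imp_iff.1 h' u hu (provable_imp_iff.1 h u hu hA)
  induction l with
  | nil => simp at hB
  | cons D l ih =>
    rw [antichain, List.foldr_cons, ← antichain]
    split_ifs with hD
    · rcases List.mem_cons.1 hB with rfl | hB
      · exact hD
      · exact ih hB
    · rcases List.mem_cons.1 hB with rfl | hB
      · exact ⟨B, List.mem_cons_self, provable_imp_iff.2 fun _ _ h => h⟩
      · obtain ⟨C, hC, hBC⟩ := ih hB
        by_cases hCD : Provable (imp C D)
        · exact ⟨D, List.mem_cons_self, htrans hBC hCD⟩
        · exact ⟨C, List.mem_cons_of_mem _ (List.mem_filter.2 ⟨hC, by simpa⟩), hBC⟩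

/-! ### Primitive recursive functions on formulas -/

section Primrec

open Encodable

theorem _root_.PrimrecPred.imp {α : Type*} [Primcodable α] {p q : α → Prop} (hp : PrimrecPred p)
    (hq : PrimrecPred q) : PrimrecPred fun a => p a → q a :=
  (hp.not.or hq).of_eq fun _ => imp_iff_not_or.symm

theorem _root_.PrimrecPred.forall_mem {α β : Type*} [Primcodable α] [Primcodable β]
    {f : α → List β} {R : β → α → Prop} (hf : Primrec f) (hR : PrimrecRel R) :
    PrimrecPred fun a => ∀ b ∈ f a, R b a :=
  hR.forall_mem_list.comp hf .id

theorem _root_.PrimrecPred.exists_mem {α β : Type*} [Primcodable α] [Primcodable β]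
    {f : α → List β} {R : β → α → Prop} (hf : Primrec f) (hR : PrimrecRel R) :
    PrimrecPred fun a => ∃ b ∈ f a, R b a :=
  hR.exists_mem_list.comp hf .id

theorem _root_.Primrec.filter_mem {α β : Type*} [Primcodable α] [Primcodable β]
    {f : α → List β} {R : β → α → Prop} [DecidableRel R] (hf : Primrec f) (hR : PrimrecRel R) :
    Primrec fun a => (f a).filter fun b => R b a :=
  hR.listFilter.comp hf .id

theorem primrecRel_mem (α : Type*) [Primcodable α] :
    PrimrecRel fun (a : α) (l : List α) => a ∈ l := by
  have h : PrimrecRel fun (l : List α) (a : α) => ∃ b ∈ l, b = a := Primrec.eq.exists_mem_list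
  exact (h.comp Primrec.snd Primrec.fst).of_eq fun p => by simp

theorem primrecRel_subset (α : Type*) [Primcodable α] :
    PrimrecRel fun l l' : List α => l ⊆ l' :=
  (primrecRel_mem α).forall_mem_list

theorem primrec_sublists' (α : Type*) [Primcodable α] :
    Primrec (List.sublists' : List α → List (List α)) := by
  have h : Primrec fun l : List α =>
      l.foldr (fun a r => r ++ r.map (List.cons a)) [[]] := by
    refine Primrec.list_foldr (h := fun _ (p : α × List (List α)) => p.2 ++ p.2.map (List.cons p.1))
      .id (.const _) ?_
    refine Primrec.list_append.comp (Primrec.snd.comp .snd) (.list_map (Primrec.snd.comp .snd) ?_)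
    exact Primrec.list_cons.comp (Primrec.fst.comp (Primrec.snd.comp .fst)) .snd
  refine h.of_eq fun l => ?_
  induction l with
  | nil => rfl
  | cons a l ih => rw [List.foldr_cons, ih, List.sublists'_cons]

variable {m k : ℕ}

/-- A number for the outermost symbol of a formula. -/
def kind : Formula (Fin m) (Fin k) → ℕ
  | atom _ => 0
  | bot => 1
  | Formula.and _ _ => 2
  | Formula.or _ _ => 3
  | imp _ _ => 4

/-- The immediate subformulas. -/
def args : Formula (Fin m) (Fin k) → List (Formula (Fin m) (Fin k))
  | atom _ => []
  | bot => []
  | Formula.and A B => [A, B]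
  | Formula.or A B => [A, B]
  | imp A B => [A, B]

theorem encode_eq_toCode (A : Formula (Fin m) (Fin k)) : encode A = toCode A := rfl

theorem primrec_kind : Primrec (kind : Formula (Fin m) (Fin k) → ℕ) := by
  have h : Primrec fun A : Formula (Fin m) (Fin k) =>
      if encode A < m + k then 0 else if encode A = m + k then 1 else
        2 + (encode A - (m + k + 1)) % 3 :=
    .ite (Primrec.nat_lt.comp .encode (.const _)) (.const _)
      (.ite (Primrec.eq.comp .encode (.const _)) (.const _)
        (Primrec.nat_add.comp (.const _) (Primrec.nat_mod.comp
          (Primrec.nat_sub.comp .encode (.const _)) (.const _))))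
  refine h.of_eq fun A => ?_
  simp only [encode_eq_toCode]
  cases A with
  | atom a =>
    rcases a with i | j
    · have := i.isLt
      rw [toCode, if_pos (by omega)]; rfl
    · have := j.isLt
      rw [toCode, if_pos (by omega)]; rfl
  | bot => simp [toCode, kind]
  | and A B | or A B | imp A B =>
    rw [toCode, if_neg (by omega), if_neg (by omega), kind]
    omega

theorem primrec_args :
    Primrec (args : Formula (Fin m) (Fin k) → List (Formula (Fin m) (Fin k))) := by
  have hu : Primrec fun A : Formula (Fin m) (Fin k) => ((encode A - (m + k + 1)) / 3).unpair :=
    Primrec.unpair.comp (Primrec.nat_div.comp (Primrec.nat_sub.comp .encode (.const _)) (.const _))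
  have h : Primrec fun A : Formula (Fin m) (Fin k) =>
      if encode A ≤ m + k then [] else
        [Denumerable.ofNat (Formula (Fin m) (Fin k)) ((encode A - (m + k + 1)) / 3).unpair.1,
          Denumerable.ofNat (Formula (Fin m) (Fin k)) ((encode A - (m + k + 1)) / 3).unpair.2] :=
    .ite (Primrec.nat_le.comp .encode (.const _)) (.const _)
      (Primrec.list_cons.comp ((Primrec.ofNat _).comp (Primrec.fst.comp hu))
        (Primrec.list_cons.comp ((Primrec.ofNat _).comp (Primrec.snd.comp hu)) (.const _)))
  refine h.of_eq fun A => ?_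
  simp only [encode_eq_toCode]
  have key : ∀ (B C : Formula (Fin m) (Fin k)) (n : ℕ),
      n = Nat.pair (toCode B) (toCode C) →
      [Denumerable.ofNat (Formula (Fin m) (Fin k)) n.unpair.1,
        Denumerable.ofNat (Formula (Fin m) (Fin k)) n.unpair.2] = [B, C] := by
    rintro B C _ rfl
    simp only [Nat.unpair_pair, ← encode_eq_toCode, Denumerable.ofNat_encode]
  cases A with
  | atom a =>
    rcases a with i | j
    · have := i.isLt
      rw [toCode, if_pos (by omega)]; rfl
    · have := j.isLt
      rw [toCode, if_pos (by omega)]; rfl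
  | bot => simp [toCode, args]
  | and A B | or A B | imp A B =>
    rw [toCode, if_neg (by omega), args, key A B _ (by omega)]

theorem encode_lt_of_mem_args {A B : Formula (Fin m) (Fin k)} (h : B ∈ args A) :
    encode B < encode A := by
  simp only [encode_eq_toCode]
  cases A with
  | atom a | bot => simp [args] at h
  | and C D | or C D | imp C D =>
    have h1 := Nat.left_le_pair (toCode C) (toCode D)
    have h2 := Nat.right_le_pair (toCode C) (toCode D)
    simp only [args, List.mem_cons, List.not_mem_nil, or_false] at h
    rw [toCode]
    rcases h with rfl | rfl <;> omega

/-- Structural recursion on formulas is primitive recursive. -/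
theorem primrec₂_of_args {α σ : Type*} [Primcodable α] [Primcodable σ]
    {f : α → Formula (Fin m) (Fin k) → σ} {g : α → Formula (Fin m) (Fin k) × List σ → σ}
    (hg : Primrec₂ g) (H : ∀ a D, g a (D, (args D).map (f a)) = f a D) : Primrec₂ f :=
  Primrec.nat_omega_rec f (m := fun _ D => encode D) (l := fun _ D => args D)
    (g := fun a p => some (g a p)) (Primrec.encode.comp Primrec.snd) (primrec_args.comp Primrec.snd)
    (Primrec.option_some.comp hg) (fun _ _ _ h => encode_lt_of_mem_args h)
    fun a D => congrArg some (H a D)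

theorem primrec₂_constructor {f : Formula (Fin m) (Fin k) → Formula (Fin m) (Fin k) →
    Formula (Fin m) (Fin k)} (c : ℕ)
    (hf : ∀ A B, toCode (f A B) = 3 * Nat.pair (toCode A) (toCode B) + c) : Primrec₂ f := by
  refine Primrec.encode_iff.1 (Primrec.of_eq (f := fun p : Formula (Fin m) (Fin k) × _ =>
    3 * Nat.pair (encode p.1) (encode p.2) + c) ?_ fun p => (hf p.1 p.2).symm)
  exact Primrec.nat_add.comp (Primrec.nat_mul.comp (.const _)
    (Primrec₂.natPair.comp (Primrec.encode.comp .fst) (Primrec.encode.comp .snd))) (.const _)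

theorem primrec₂_and : Primrec₂ (Formula.and (V := Fin m) (P := Fin k)) :=
  primrec₂_constructor (m + k + 1) fun _ _ => rfl

theorem primrec₂_or : Primrec₂ (Formula.or (V := Fin m) (P := Fin k)) :=
  primrec₂_constructor (1 + (m + k + 1)) fun _ _ => by rw [toCode]; omega

theorem primrec₂_imp : Primrec₂ (imp (V := Fin m) (P := Fin k)) :=
  primrec₂_constructor (2 + (m + k + 1)) fun _ _ => by rw [toCode]; omega

theorem primrec_listConj : Primrec (listConj (V := Fin m) (P := Fin k)) := by
  have h : Primrec fun l : List (Formula (Fin m) (Fin k)) => l.foldr Formula.and top :=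
    Primrec.list_foldr (h := fun _ p => Formula.and p.1 p.2) .id (.const _)
      (primrec₂_and.comp (Primrec.fst.comp .snd) (Primrec.snd.comp .snd))
  refine h.of_eq fun l => ?_
  induction l with
  | nil => rfl
  | cons A l ih => rw [List.foldr_cons, ih, listConj]

theorem primrec_listDisj : Primrec (listDisj (V := Fin m) (P := Fin k)) := by
  have h : Primrec fun l : List (Formula (Fin m) (Fin k)) => l.foldr Formula.or bot :=
    Primrec.list_foldr (h := fun _ p => Formula.or p.1 p.2) .id (.const _)
      (primrec₂_or.comp (Primrec.fst.comp .snd) (Primrec.snd.comp .snd))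
  refine h.of_eq fun l => ?_
  induction l with
  | nil => rfl
  | cons A l ih => rw [List.foldr_cons, ih, listDisj]

theorem primrec_impDepth : Primrec (impDepth (V := Fin m) (P := Fin k)) := by
  have h : Primrec₂ fun (_ : Unit) (D : Formula (Fin m) (Fin k)) => D.impDepth := by
    refine primrec₂_of_args (g := fun _ p =>
      (if kind p.1 = 4 ∧ p.1 ≠ imp bot bot then 1 else 0) + max (p.2.getI 0) (p.2.getI 1)) ?_ ?_
    · have hD : Primrec fun q : Unit × Formula (Fin m) (Fin k) × List ℕ => q.2.1 :=
        Primrec.fst.comp .snd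
      have hl : Primrec fun q : Unit × Formula (Fin m) (Fin k) × List ℕ => q.2.2 :=
        Primrec.snd.comp .snd
      exact Primrec.nat_add.comp
        (.ite ((Primrec.eq.comp (primrec_kind.comp hD) (.const 4)).and
          (Primrec.eq.comp hD (.const (imp bot bot))).not) (.const 1) (.const 0))
        (Primrec.nat_max.comp (Primrec.list_getI.comp hl (.const 0))
          (Primrec.list_getI.comp hl (.const 1)))
    · intro _ D
      cases D with
      | imp A B =>
        rcases impDepth_imp A B with ⟨rfl, rfl, h⟩ | h
        · simp [kind, args, List.getI, impDepth]
        · by_cases h' : A = bot ∧ B = bot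
          · obtain ⟨rfl, rfl⟩ := h'
            simp [kind, args, List.getI, impDepth]
          · simp [kind, args, List.getI, h, h']
      | _ => simp [kind, args, List.getI, impDepth]
  exact h.comp (.const ()) .id

theorem primrec_subf : Primrec (subf (V := Fin m) (P := Fin k)) := by
  have h : Primrec₂ fun (_ : Unit) (D : Formula (Fin m) (Fin k)) => subf D := by
    refine primrec₂_of_args (g := fun _ p => p.1 :: p.2.flatten) ?_ ?_
    · exact Primrec.list_cons.comp (Primrec.fst.comp .snd)
        (Primrec.list_flatten.comp (Primrec.snd.comp .snd))
    · intro _ D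
      cases D <;> simp [args, subf]
  exact h.comp (.const ()) .id

theorem primrec₂_truth : Primrec₂ (truth (V := Fin m) (P := Fin k)) := by
  let F := Formula (Fin m) (Fin k)
  refine primrec₂_of_args (g := fun M p =>
    if kind p.1 = 0 then M.filter fun w => p.1 ∈ w
    else if kind p.1 = 1 then []
    else if kind p.1 = 2 then M.filter fun w => w ∈ p.2.getI 0 ∧ w ∈ p.2.getI 1
    else if kind p.1 = 3 then M.filter fun w => w ∈ p.2.getI 0 ∨ w ∈ p.2.getI 1
    else M.filter fun w => ∀ v ∈ M, w ⊆ v → v ∈ p.2.getI 0 → v ∈ p.2.getI 1) ?_ ?_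
  · have hM : Primrec fun q : List (List F) × F × List (List (List F)) => q.1 := .fst
    have hD : Primrec fun q : List (List F) × F × List (List (List F)) => q.2.1 :=
      Primrec.fst.comp .snd
    have hl : ∀ i, Primrec fun q : List (List F) × F × List (List (List F)) => q.2.2.getI i :=
      fun i => Primrec.list_getI.comp (Primrec.snd.comp .snd) (.const i)
    have hk : ∀ i, PrimrecPred fun q : List (List F) × F × List (List (List F)) =>
        kind q.2.1 = i := fun i => Primrec.eq.comp (primrec_kind.comp hD) (.const i)
    have hmem : ∀ i, PrimrecRel fun (w : List F) (q : List (List F) × F × List (List (List F))) =>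
        w ∈ q.2.2.getI i := fun i => (primrecRel_mem _).comp .fst ((hl i).comp .snd)
    refine .ite (hk 0) (.filter_mem hM ?_) (.ite (hk 1) (.const _)
      (.ite (hk 2) (.filter_mem hM ?_) (.ite (hk 3) (.filter_mem hM ?_) (.filter_mem hM ?_))))
    · exact (primrecRel_mem _).comp (hD.comp .snd) .fst
    · exact (hmem 0).and (hmem 1)
    · exact (hmem 0).or (hmem 1)
    · refine PrimrecPred.forall_mem (hM.comp .snd) ?_
      refine PrimrecPred.imp ((primrecRel_subset _).comp (Primrec.fst.comp .snd) .fst) ?_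
      exact PrimrecPred.imp ((hmem 0).comp .fst (Primrec.snd.comp .snd))
        ((hmem 1).comp .fst (Primrec.snd.comp .snd))
  · intro M D
    cases D <;> simp [kind, args, truth, List.getI]

/-- Intuitionistic provability is decidable, by the finite model property. -/
theorem primrecPred_provable : PrimrecPred (Provable (V := Fin m) (P := Fin k)) := by
  refine PrimrecPred.of_eq (PrimrecPred.forall_mem (R := fun M A => ∀ w ∈ M, w ∈ truth M A)
    ((primrec_sublists' _).comp ((primrec_sublists' _).comp primrec_subf)) ?_)
    fun A => provable_iff_truth.symm
  refine PrimrecPred.forall_mem (R := fun w (p : List (List (Formula (Fin m) (Fin k))) × _) =>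
    w ∈ truth p.1 p.2) .fst ?_
  exact (primrecRel_mem _).comp .fst (primrec₂_truth.comp (Primrec.fst.comp .snd)
    (Primrec.snd.comp .snd))

theorem primrecRel_slash : PrimrecRel fun
    (p : List (Formula (Fin m) (Fin k)) × List (Formula (Fin m) (Fin k)))
    (D : Formula (Fin m) (Fin k)) => Slash (fun a => atom a ∈ p.1) {E | E ∈ p.2} D := by
  classical
  let F := Formula (Fin m) (Fin k)
  have h : Primrec₂ fun (p : List F × List F) (D : F) =>
      decide (Slash (fun a => atom a ∈ p.1) {E | E ∈ p.2} D) := by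
    refine primrec₂_of_args (g := fun p q =>
      if kind q.1 = 0 then decide (q.1 ∈ p.1 ∧ q.1 ∈ p.2)
      else if kind q.1 = 1 then false
      else if kind q.1 = 2 then q.2.getI 0 && q.2.getI 1
      else if kind q.1 = 3 then q.2.getI 0 || q.2.getI 1
      else (!q.2.getI 0 || q.2.getI 1) && decide (q.1 ∈ p.2)) ?_ ?_
    · have hD : Primrec fun r : (List F × List F) × F × List Bool => r.2.1 := Primrec.fst.comp .snd
      have hl : ∀ i, Primrec fun r : (List F × List F) × F × List Bool => r.2.2.getI i :=
        fun i => Primrec.list_getI.comp (Primrec.snd.comp .snd) (.const i)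
      have hk : ∀ i, PrimrecPred fun r : (List F × List F) × F × List Bool =>
          kind r.2.1 = i := fun i => Primrec.eq.comp (primrec_kind.comp hD) (.const i)
      have hS : PrimrecPred fun r : (List F × List F) × F × List Bool => r.2.1 ∈ r.1.2 :=
        (primrecRel_mem _).comp hD (Primrec.snd.comp .fst)
      have hZ : PrimrecPred fun r : (List F × List F) × F × List Bool => r.2.1 ∈ r.1.1 :=
        (primrecRel_mem _).comp hD (Primrec.fst.comp .fst)
      exact .ite (hk 0) (hZ.and hS).decide (.ite (hk 1) (.const _)
        (.ite (hk 2) (Primrec.and.comp (hl 0) (hl 1)) (.ite (hk 3) (Primrec.or.comp (hl 0) (hl 1))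
          (Primrec.and.comp (Primrec.or.comp (Primrec.not.comp (hl 0)) (hl 1)) hS.decide))))
    · intro p D
      rw [Bool.eq_iff_iff, decide_eq_true_eq]
      cases D <;> simp [kind, args, Slash, List.getI, imp_iff_not_or]
  exact Primrec.primrecPred h

theorem primrecRel_hasFiniteExtension (vs ps : List (Formula (Fin m) (Fin k))) :
    PrimrecRel fun C B => HasFiniteExtension vs ps B C := by
  let F := Formula (Fin m) (Fin k)
  have hC : Primrec fun q : F × F => q.1 := .fst
  have hB : Primrec fun q : F × F => q.2 := .snd
  have hΦ : Primrec fun q : F × F => subf q.2 ++ subf q.1 :=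
    Primrec.list_append.comp (primrec_subf.comp hB) (primrec_subf.comp hC)
  refine PrimrecPred.forall_mem (f := fun q : F × F => (subf q.2 ++ subf q.1).sublists')
    (R := fun S q =>
      (∀ D ∈ subf q.2 ++ subf q.1, Provable (imp (listConj (q.2 :: S)) D) → D ∈ S) →
      ∀ Y ∈ ps.sublists', Slash (fun a => atom a ∈ Y) {D | D ∈ S} q.1 →
      ∃ X ∈ vs.sublists', Slash (fun a => atom a ∈ X ++ Y) {D | D ∈ S} q.2)
    ((primrec_sublists' _).comp hΦ) (PrimrecPred.imp ?_ ?_)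
  · refine PrimrecPred.forall_mem (f := fun r : List F × F × F => subf r.2.2 ++ subf r.2.1)
      (R := fun D r => Provable (imp (listConj (r.2.2 :: r.1)) D) → D ∈ r.1) (hΦ.comp .snd)
      (PrimrecPred.imp ?_ ?_)
    · refine primrecPred_provable.comp (primrec₂_imp.comp (primrec_listConj.comp ?_) .fst)
      exact Primrec.list_cons.comp (hB.comp (Primrec.snd.comp .snd)) (Primrec.fst.comp .snd)
    · exact (primrecRel_mem _).comp .fst (Primrec.fst.comp .snd)
  · refine PrimrecPred.forall_mem (f := fun r : List F × F × F => ps.sublists')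
      (R := fun Y r => Slash (fun a => atom a ∈ Y) {D | D ∈ r.1} r.2.1 →
        ∃ X ∈ vs.sublists', Slash (fun a => atom a ∈ X ++ Y) {D | D ∈ r.1} r.2.2) (.const _)
      (PrimrecPred.imp ?_ ?_)
    · exact primrecRel_slash.comp (.pair .fst (Primrec.fst.comp .snd))
        (hC.comp (Primrec.snd.comp .snd))
    · refine PrimrecPred.exists_mem (f := fun s : List F × List F × F × F => vs.sublists')
        (R := fun X s => Slash (fun a => atom a ∈ X ++ s.1) {D | D ∈ s.2.1} s.2.2.2) (.const _) ?_
      exact primrecRel_slash.comp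
        (.pair (Primrec.list_append.comp .fst (Primrec.fst.comp .snd))
          (Primrec.fst.comp (Primrec.snd.comp .snd)))
        (hB.comp (Primrec.snd.comp (Primrec.snd.comp .snd)))

theorem primrec_dnf : Primrec (dnf (V := Fin m) (P := Fin k)) :=
  .list_map ((primrec_sublists' _).comp (.list_map (primrec_sublists' _)
    (primrec_listConj.comp .snd))) (primrec_listDisj.comp .snd)

theorem primrec_reps (G : List (Formula (Fin m) (Fin k))) : Primrec (reps G) := by
  have h : Primrec fun n : ℕ => (Nat.rec (dnf G)
      (fun _ r => dnf (G ++ r.flatMap fun D => r.map (imp D))) n :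
        List (Formula (Fin m) (Fin k))) := by
    refine Primrec.nat_rec₁ _ (primrec_dnf.comp (Primrec.list_append.comp (.const _)
      (.list_flatMap .snd (.list_map (Primrec.snd.comp .fst) ?_))))
    exact primrec₂_imp.comp (Primrec.snd.comp .fst) .snd
  refine h.of_eq fun n => ?_
  induction n with
  | zero => rfl
  | succ n ih => rw [reps, ← ih]

theorem primrec_antichain : Primrec (antichain (V := Fin m) (P := Fin k)) := by
  classical
  let F := Formula (Fin m) (Fin k)
  have hp : PrimrecRel fun A B : F => Provable (imp A B) := primrecPred_provable.comp primrec₂_imp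
  refine Primrec.list_foldr (h := fun _ (p : F × List F) => if ∃ D ∈ p.2, Provable (imp p.1 D)
    then p.2 else p.1 :: p.2.filter fun D => ¬ Provable (imp D p.1)) .id (.const _) ?_
  have h1 : Primrec fun q : List F × F × List F => q.2.1 := Primrec.fst.comp .snd
  have h2 : Primrec fun q : List F × F × List F => q.2.2 := Primrec.snd.comp .snd
  refine .ite (PrimrecPred.exists_mem h2 ?_) h2 (Primrec.list_cons.comp h1 (.filter_mem h2 ?_))
  · exact hp.comp (h1.comp .snd) .fst
  · exact PrimrecPred.not (hp.comp .fst (h1.comp .snd))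

end Primrec

end RelUnif

open RelUnif in
theorem mainTheorem3 (m k : ℕ) :
    ∃ Res : RelUnif.Formula (Fin m) (Fin k) → List (RelUnif.Formula (Fin m) (Fin k)),
      Computable Res ∧
      ∀ A : RelUnif.Formula (Fin m) (Fin k),
        RelUnif.IsProjectiveResolution (RelUnif.NNILpar (Fin m) (Fin k)) (Res A).toFinset A ∧
        ∀ B ∈ Res A, B.impDepth ≤ max A.impDepth (1 + k) := by
  classical
  let vs : List (Formula (Fin m) (Fin k)) := (List.finRange m).map fun x => .atom (Sum.inl x)
  let ps : List (Formula (Fin m) (Fin k)) := (List.finRange k).map fun p => .atom (Sum.inr p)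
  have hvs : ∀ A, A ∈ vs ↔ ∃ x, A = .atom (Sum.inl x) := fun A => by simp [vs, eq_comm]
  have hps : ∀ A, A ∈ ps ↔ ∃ p, A = .atom (Sum.inr p) := fun A => by simp [ps, eq_comm]
  have hG : ∀ a, .atom a ∈ vs ++ ps := by rintro (x | p) <;> simp [hvs, hps]
  have hG0 : ∀ A ∈ vs ++ ps, A.impDepth = 0 := by
    intro A hA
    rcases List.mem_append.1 hA with h | h
    · obtain ⟨x, rfl⟩ := (hvs A).1 h; rfl
    · obtain ⟨p, rfl⟩ := (hps A).1 h; rfl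
  obtain ⟨L, hL, hL'⟩ := exists_list_NNILpar hG
  rw [Fintype.card_fin] at hL
  -- by the extension property, these are the projective formulas implying `A`, tested effectively
  let Good : Formula (Fin m) (Fin k) → Formula (Fin m) (Fin k) → Prop := fun B A =>
    Provable (.imp B A) ∧ ∃ C ∈ L, HasFiniteExtension vs ps B C ∧ Provable (.imp B C)
  let N : Formula (Fin m) (Fin k) → ℕ := fun A => max A.impDepth (1 + k)
  let cand : Formula (Fin m) (Fin k) → List (Formula (Fin m) (Fin k)) := fun A =>
    (reps (vs ++ ps) (N A)).filter fun B => Good B A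
  have hmem : ∀ {A B}, B ∈ antichain (cand A) → B ∈ reps (vs ++ ps) (N A) ∧ Good B A := by
    intro A B hB
    simpa using List.mem_filter.1 (mem_of_mem_antichain hB)
  refine ⟨fun A => antichain (cand A), ?_, fun A => ⟨⟨?_, ?_, ?_, ?_⟩, ?_⟩⟩
  · have hp : PrimrecRel fun A B : Formula (Fin m) (Fin k) => Provable (.imp A B) :=
      primrecPred_provable.comp primrec₂_imp
    refine (primrec_antichain.comp (.filter_mem ((primrec_reps _).comp
      (Primrec.nat_max.comp primrec_impDepth (.const _))) ?_)).to_comp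
    refine hp.and (PrimrecPred.exists_mem (R := fun C (q : Formula (Fin m) (Fin k) × _) =>
      HasFiniteExtension vs ps q.1 C ∧ Provable (.imp q.1 C)) (.const L) ?_)
    have h1 : Primrec fun r : Formula (Fin m) (Fin k) × Formula (Fin m) (Fin k) ×
        Formula (Fin m) (Fin k) => r.2.1 := Primrec.fst.comp .snd
    exact PrimrecPred.and ((primrecRel_hasFiniteExtension vs ps).comp .fst h1) (hp.comp h1 .fst)
  · intro B hB C hC h
    exact antichain_independent (List.mem_toFinset.1 hB) (List.mem_toFinset.1 hC) h
  · intro B hB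
    obtain ⟨-, -, C, hC, hext, hBC⟩ := hmem (List.mem_toFinset.1 hB)
    have hCp := (hL C hC).1.2
    exact ((hasFiniteExtension_iff hvs hps hCp).1 hext).isProjective hCp (hL C hC).1 hBC
  · intro θ C₀ hC₀ hCA
    obtain ⟨C, hC, hCC⟩ := hL' C₀ hC₀
    have hCp := (hL C hC).1.2
    -- the bound `1 + k` leaves room for `C`, of depth at most `k`, one level below `N A`
    obtain ⟨n, hn⟩ : ∃ n, N A = n + 1 := ⟨N A - 1, by simp only [N]; omega⟩
    have hkn : k ≤ n := by simp only [N] at hn; omega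
    have hAn : A.impDepth ≤ n + 1 := hn ▸ le_max_left _ _
    simp only [Subst.app, θ.app_eq_self hC₀.2, provable_imp_iff] at hCA ⊢
    obtain ⟨B, hB, hext, hBC, hBA, hCB⟩ := exists_hasExtension (θ := θ) hG hG0 hCp
      ((hL C hC).2.trans hkn) hAn (provable_imp_iff.2 fun u hu h => hCA u hu ((hCC u hu).2 h))
    have hBcand : B ∈ cand A := List.mem_filter.2 ⟨hn ▸ hB, by
      simpa using ⟨hBA, C, hC, (hasFiniteExtension_iff hvs hps hCp).2 hext, hBC⟩⟩
    obtain ⟨D, hD, hBD⟩ := exists_mem_antichain hBcand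
    intro u hu h
    refine (hu.comap θ).bigOr_mem_iff.2 ⟨D, List.mem_toFinset.2 hD, ?_⟩
    exact provable_imp_iff.1 hBD _ (hu.comap θ)
      (provable_imp_iff.1 hCB u hu ((hCC u hu).1 h))
  · refine provable_imp_iff.2 fun u hu h => ?_
    obtain ⟨B, hB, hBu⟩ := hu.bigOr_mem_iff.1 h
    exact provable_imp_iff.1 (hmem (List.mem_toFinset.1 hB)).2.1 u hu hBu
  · exact fun B hB => impDepth_le_of_mem_reps hG0 _ B (hmem hB).1
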